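/- **Circuits and encodings.** A $\mathsf{TC}^0$ family is a (not necessarily uniform) family of circuits with unbounded fan-in $\mathsf{MAJORITY}$ gates and $\neg$ gates, of constant depth, and of size (gates plus wires) polynomial in the parameters that index the family. Integers are encoded in sign-magnitude form (a sign bit and a binary magnitude), and rationals as a fraction of a signed integer by a nonzero natural number (not necessarily reduced). An object has bit length $w$ if all magnitudes, numerators and denominators occurring in it are written with $w$ bits. **Classes.** Let $\mathcal G$ be the class of integer matrices that have at least one nonzero entry in every row and in every column. Let $\mathcal G_z\subset\mathcal G$ be the class of those matrices in $\mathcal G$ in which every row sums to zero. Let $\mathcal G_{z,2}\subset\mathcal G_z$ be the class of those matrices in $\mathcal G_z$ in which the positive entries of every row sum to a power of $2$ (that is, to $2^k$ for some integer $k\ge 0$). Let $\mathcal{MC}_2$ be the class of (integer) $2$-commodity matrices: the columns are indexed by variables $x_1,\dots,x_k,y_1,\dots,y_k$, and each row is the coefficient vector of a nonzero multiple of $x_i-x_j$, of $y_i-y_j$, or of $x_i-y_i-(x_j-y_j)$, for some $i\neq j$ (columns of $\mathcal{MC}_2$ matrices may be zero). **Reductions.** A $\mathsf{TC}^0$-reduction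 from exactly solving linear systems in a class $\mathcal C$ to exactly solving linear systems in a class $\mathcal D$ consists of two $\mathsf{TC}^0$ families $F=(F_{m,n,w})$, of size $\mathrm{poly}(m,n,w)$, and $R=(R_{m,n,w,\ell})$, of size $\mathrm{poly}(m,n,w,\ell)$, such that for every $m\times n$ matrix $A\in\mathcal C$ and every rational vector $b$, both of bit length $w$: 1. given any encoding of $(A,b)$, the circuit $F_{m,n,w}$ outputs an encoding, of length polynomial in $m,n,w$, of a matrix $A'\in\mathcal D$ (together with its dimensions $m'\times n'$) and a rational vector $b'$; 2. $Ax=b$ has a solution over $\mathbb R$ if and only if $A'x'=b'$ has a solution over $\mathbb R$; 3. given any encoding of bit length $\ell$ of any rational solution $x'$ of $A'x'=b'$, the circuit $R_{m,n,w,\ell}$ outputs an encoding, of length polynomial in $m,n,w,\ell$, of a rational solution $x$ of $Ax=b$. (The input of $R_{m,n,w,\ell}$ is $x'$ only, placed at the beginning of a buffer whose length $N(m,n,w)\ge n'$ depends only on $m,n,w$ and whose remaining entries are arbitrary.) **Lemma.** There are $\mathsf{TC}^0$-reductions between exact solvers (i) from $\mathcal G$ to $\mathcal G_z$; (ii) from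 $\mathcal G_z$ to $\mathcal G_{z,2}$; (iii) from $\mathcal G_{z,2}$ to $\mathcal{MC}_2$. -/

import Mathlib

namespace TC0Lin

/-! ### Threshold circuits -/

/-- A gate operation whose input wires are labelled by elements of `α`: negation, or `MAJORITY`
of arbitrary fan-in `k` (the same wire may be used several times, counted with multiplicity). -/
inductive GateOp (α : Type) : Type
  | not (a : α) : GateOp α
  | maj (k : ℕ) (a : Fin k → α) : GateOp α

namespace GateOp

/-- The set of wires that a gate reads. -/
def inputs {α : Type} : GateOp α → Set α
  | not a => {a}
  | maj _ a => Set.range a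

/-- The number of wires entering a gate, with multiplicity. -/
def fanIn {α : Type} : GateOp α → ℕ
  | not _ => 1
  | maj k _ => k

/-- The Boolean function of a gate: `MAJORITY` is true iff at least half of its inputs are. -/
def eval {α : Type} (v : α → Bool) : GateOp α → Bool
  | not a => !(v a)
  | maj k a => decide (k ≤ 2 * (Finset.univ.filter fun i => v (a i) = true).card)

theorem eval_congr {α : Type} {v v' : α → Bool} (o : GateOp α)
    (h : ∀ a ∈ o.inputs, v a = v' a) : o.eval v = o.eval v' := by
  cases o with
  | not a => simp [eval, h a (by simp [inputs])]
  | maj k a =>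
    have h2 : ∀ i, v (a i) = v' (a i) := fun i => h (a i) (by simp [inputs])
    simp [eval, h2]

end GateOp

/-- A circuit of unbounded fan-in `MAJORITY` and negation gates, with input wires `ι` and output
wires `κ`. The function `level` certifies acyclicity: a gate only reads circuit inputs
and gates of smaller level. -/
structure Circuit (ι κ : Type) : Type 1 where
  Gate : Type
  fintypeGate : Fintype Gate
  op : Gate → GateOp (ι ⊕ Gate)
  level : Gate → ℕ
  level_lt : ∀ g h : Gate, Sum.inr h ∈ (op g).inputs → level h < level g
  out : κ → ι ⊕ Gate

namespace Circuit

variable {ι κ : Type}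

open Classical in
/-- The value of a gate on input `x`, by recursion on the level. -/
noncomputable def gateVal (C : Circuit ι κ) (x : ι → Bool) (g : C.Gate) : Bool :=
  (C.op g).eval fun a =>
    match a with
    | Sum.inl i => x i
    | Sum.inr h => if _hh : Sum.inr h ∈ (C.op g).inputs then C.gateVal x h else false
termination_by C.level g
decreasing_by exact C.level_lt _ _ _hh

/-- Every gate has the value that its operation assigns to the values of the wires it reads. -/
theorem gateVal_eq (C : Circuit ι κ) (x : ι → Bool) (g : C.Gate) :
    C.gateVal x g = (C.op g).eval (Sum.elim x (C.gateVal x)) := by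
  rw [gateVal]
  apply GateOp.eval_congr
  rintro (i | h) ha
  · rfl
  · simp [ha]

/-- The function computed by a circuit. -/
noncomputable def eval (C : Circuit ι κ) (x : ι → Bool) : κ → Bool :=
  fun k => Sum.elim x (C.gateVal x) (C.out k)

/-- The number of gates plus the number of wires entering gates. -/
def size (C : Circuit ι κ) : ℕ :=
  letI := C.fintypeGate
  ∑ g : C.Gate, (1 + (C.op g).fanIn)

/-- The number of levels of gates; it bounds the number of gates on any path. -/
def depth (C : Circuit ι κ) : ℕ :=
  letI := C.fintypeGate
  Finset.univ.sup fun g : C.Gate => C.level g + 1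

end Circuit

/-- `f` is bounded by a polynomial in the size parameter `s`. -/
def PolyBounded {P : Type} (s : P → ℕ) (f : P → ℕ) : Prop :=
  ∃ c : ℕ, ∀ p, f p ≤ c * (s p + 1) ^ c

/-- A family of circuits is a `TC⁰` family, with respect to the size parameter `s`, if it has
bounded depth and size polynomial in `s`. -/
def IsTC0 {P : Type} (s : P → ℕ) {ι κ : P → Type} (C : ∀ p, Circuit (ι p) (κ p)) : Prop :=
  (∃ d : ℕ, ∀ p, (C p).depth ≤ d) ∧ PolyBounded s fun p => (C p).size

/-! ### Binary encodings -/

/-- The wires of a `w`-bit signed integer: a sign bit `none` and `w` bits of magnitude. -/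
abbrev IntWire (w : ℕ) : Type := Option (Fin w)

/-- The wires of a rational number: a `w`-bit signed numerator and a `w`-bit denominator. -/
abbrev RatWire (w : ℕ) : Type := IntWire w ⊕ Fin w

/-- The wires of a linear system `A x = b` with `m` equations and `n` unknowns. -/
abbrev SysWire (m n w : ℕ) : Type := (Fin m × Fin n × IntWire w) ⊕ (Fin m × RatWire w)

/-- The wires of a linear system with at most `M` equations and at most `N` unknowns: a buffer
for a system of size `M × N`, then the actual number of equations and of unknowns. -/
abbrev PadWire (M N w : ℕ) : Type := SysWire M N w ⊕ (Fin w ⊕ Fin w)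

/-- Value of a bit string in binary; bit `i` has weight `2 ^ i`. -/
def natVal {w : ℕ} (u : Fin w → Bool) : ℕ :=
  ∑ i, if u i = true then 2 ^ (i : ℕ) else 0

/-- Value of a bit string in sign-magnitude representation (sign bit true: negative). -/
def intVal {w : ℕ} (u : IntWire w → Bool) : ℤ :=
  (if u none = true then -1 else 1) * (natVal fun i => u (some i) : ℤ)

/-- `u` represents `q` as a fraction, not necessarily reduced, with nonzero denominator. -/
def EncodesRat {w : ℕ} (u : RatWire w → Bool) (q : ℚ) : Prop :=
  natVal (fun i => u (Sum.inr i)) ≠ 0 ∧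
    q = (intVal (fun t => u (Sum.inl t)) : ℚ) / (natVal (fun i => u (Sum.inr i)) : ℚ)

/-- `u` represents the linear system with matrix `A` and right-hand side `b`. -/
def EncodesSystem {m n w : ℕ} (u : SysWire m n w → Bool)
    (A : Matrix (Fin m) (Fin n) ℤ) (b : Fin m → ℚ) : Prop :=
  (∀ i j, intVal (fun t => u (Sum.inl (i, j, t))) = A i j) ∧
    ∀ i, EncodesRat (fun t => u (Sum.inr (i, t))) (b i)

/-- `u` represents the system `(A, b)` in the upper left corner of a buffer of size `M × N`,
together with the dimensions of `A` in binary; the rest of the buffer is ignored. -/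
def EncodesPadded {M N w m n : ℕ} (u : PadWire M N w → Bool)
    (A : Matrix (Fin m) (Fin n) ℤ) (b : Fin m → ℚ) : Prop :=
  natVal (fun i => u (Sum.inr (Sum.inl i))) = m ∧
  natVal (fun i => u (Sum.inr (Sum.inr i))) = n ∧
  ∃ (hm : m ≤ M) (hn : n ≤ N),
    (∀ i j, intVal (fun t => u (Sum.inl (Sum.inl (Fin.castLE hm i, Fin.castLE hn j, t)))) = A i j) ∧
    ∀ i, EncodesRat (fun t => u (Sum.inl (Sum.inr (Fin.castLE hm i, t)))) (b i)

/-- The first `n` entries of the buffer `u` of length `N` represent the vector `x`; the rest of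
the buffer is ignored. -/
def EncodesVec {N w n : ℕ} (u : Fin N × RatWire w → Bool) (x : Fin n → ℚ) : Prop :=
  ∃ hn : n ≤ N, ∀ j, EncodesRat (fun t => u (Fin.castLE hn j, t)) (x j)

/-! ### Classes of matrices -/

/-- A class of integer matrices. -/
abbrev MatrixClass : Type := ∀ m n : ℕ, Set (Matrix (Fin m) (Fin n) ℤ)

/-- Integer matrices without zero rows and zero columns. -/
def classG : MatrixClass := fun _ _ =>
  {A | (∀ i, ∃ j, A i j ≠ 0) ∧ ∀ j, ∃ i, A i j ≠ 0}

/-- Matrices in `classG` all of whose row sums are zero. -/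
def classGz : MatrixClass := fun m n =>
  {A | A ∈ classG m n ∧ ∀ i, ∑ j, A i j = 0}

/-- Matrices in `classGz` such that in every row the positive entries sum to a power of two. -/
def classGz2 : MatrixClass := fun m n =>
  {A | A ∈ classGz m n ∧ ∀ i, ∃ k : ℕ, ∑ j with 0 < A i j, A i j = 2 ^ k}

/-- The coefficient vector of the variable `x_i`, when the unknowns are
`x_1, …, x_k, y_1, …, y_k` in this order. -/
def xVar {k : ℕ} (i : Fin k) : Fin (k + k) → ℤ := Pi.single (Fin.castAdd k i) 1

/-- The coefficient vector of the variable `y_i`, when the unknowns are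
`x_1, …, x_k, y_1, …, y_k` in this order. -/
def yVar {k : ℕ} (i : Fin k) : Fin (k + k) → ℤ := Pi.single (Fin.natAdd k i) 1

/-- The coefficient vector of a nonzero scaling of `x_i - x_j`, of `y_i - y_j`, or of
`x_i - y_i - (x_j - y_j)`, for some `i ≠ j`. -/
def IsTwoCommodityRow {k : ℕ} (r : Fin (k + k) → ℤ) : Prop :=
  ∃ (c : ℤ) (i j : Fin k), c ≠ 0 ∧ i ≠ j ∧
    (r = c • (xVar i - xVar j) ∨ r = c • (yVar i - yVar j) ∨
      r = c • (xVar i - yVar i - (xVar j - yVar j)))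

/-- 2-commodity matrices (with integer coefficients). -/
def classMC2 : MatrixClass := fun _ n =>
  {A | ∃ (k : ℕ) (h : k + k = n), ∀ r, IsTwoCommodityRow fun t => A r (Fin.cast h t)}

/-! ### Reductions between exact solvers -/

/-- `x` solves the linear system `A x = b` over the field `K`. -/
def IsSol {m n : ℕ} (K : Type) [Field K] (A : Matrix (Fin m) (Fin n) ℤ) (b : Fin m → ℚ)
    (x : Fin n → K) : Prop :=
  ∀ i, ∑ j, (A i j : K) * x j = (b i : K)

/-- There is a `TC⁰`-reduction from exactly solving systems with matrix in `𝒞` to exactly solving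
systems with matrix in `𝒟`.

The circuit `F (m, n, w)` maps an `m × n` system `A x = b` of bit length `w` with `A` in `𝒞` to a
system `A' x' = b'` with `A'` in `𝒟`, solvable iff `A x = b` is. The circuit `R ((m, n, w), l)`
maps any rational solution `x'` of bit length `l` of the new system to a solution `x` of the
original one. -/
def TC0Reducible (𝒞 𝒟 : MatrixClass) : Prop :=
  ∃ (M N W : ℕ × ℕ × ℕ → ℕ) (L : (ℕ × ℕ × ℕ) × ℕ → ℕ)
    (F : ∀ p : ℕ × ℕ × ℕ, Circuit (SysWire p.1 p.2.1 p.2.2) (PadWire (M p) (N p) (W p)))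
    (R : ∀ q : (ℕ × ℕ × ℕ) × ℕ,
      Circuit (Fin (N q.1) × RatWire q.2) (Fin q.1.2.1 × RatWire (L q))),
    PolyBounded (fun p => p.1 + p.2.1 + p.2.2) M ∧
    PolyBounded (fun p => p.1 + p.2.1 + p.2.2) N ∧
    PolyBounded (fun p => p.1 + p.2.1 + p.2.2) W ∧
    PolyBounded (fun q => q.1.1 + q.1.2.1 + q.1.2.2 + q.2) L ∧
    IsTC0 (fun p => p.1 + p.2.1 + p.2.2) F ∧
    IsTC0 (fun q => q.1.1 + q.1.2.1 + q.1.2.2 + q.2) R ∧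
    ∀ (m n w : ℕ) (A : Matrix (Fin m) (Fin n) ℤ) (b : Fin m → ℚ) (u : SysWire m n w → Bool),
      A ∈ 𝒞 m n → EncodesSystem u A b →
      ∃ (m' n' : ℕ) (A' : Matrix (Fin m') (Fin n') ℤ) (b' : Fin m' → ℚ),
        A' ∈ 𝒟 m' n' ∧
        EncodesPadded ((F (m, n, w)).eval u) A' b' ∧
        ((∃ x : Fin n → ℝ, IsSol ℝ A b x) ↔ ∃ x' : Fin n' → ℝ, IsSol ℝ A' b' x') ∧
        ∀ (l : ℕ) (x' : Fin n' → ℚ) (v : Fin (N (m, n, w)) × RatWire l → Bool),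
          IsSol ℚ A' b' x' → EncodesVec v x' →
          ∃ x : Fin n → ℚ, EncodesVec ((R ((m, n, w), l)).eval v) x ∧ IsSol ℚ A b x

end TC0Lin

/-! All three reductions build a system whose shape depends only on `(m, n, w)`; only its entries
depend on the input, and in a simple way. (i) Replace `A` by `[A | -A]`: row sums vanish, and a
solution `(y, z)` gives `x = y - z`. (ii) Append pairs of unknowns `y_l, z_l` with equations `y_l -
z_l = 0`, and add `c (y_l - z_l)` with `c ≥ 0` to the rows. Solutions and row sums are not
disturbed, while the positive entries gain the sum of the `c`, chosen to reach `2 ^ (n + w)`.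
Spreading this over `n + 1` pairs makes each `c` either a constant or the bit complement of one
positive part (`sum_padCoeff`). (iii) Evaluate `A x` by a straight-line program with additions only:
repeated doubling gives `2 ^ t * x j`, and the signed binary expansion of `A` selects which of these
enter the positive and the negative sum of each row. A gadget of six 2-commodity equations performs
one addition (`program_values`). Such equations see only differences, so the program computes with
values relative to a zero vertex; as the rows of `A` sum to zero, this shift cancels
(`sum_inMat_of_sysEdge`) and the decoder merely copies coordinates. An input bit only decides
whether a gate reads a multiple of an unknown or the zero node.

On the circuit side, everything is expressed by threshold formulas of constant depth and polynomial
size (`InTC0`), closed under Boolean operations, polynomial quantifiers and counting. Carry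
look-ahead gives addition. Iterated addition of powers of two splits the exponents into blocks of
logarithmic length and treats even and odd blocks separately, so that no carries pass between
digits; this yields multiplication. `TC0Reducible.of_systems` turns such families of numbers into a
reduction. -/

namespace TC0Lin

/-! ### Polynomial bounds -/

namespace PolyBounded

variable {P : Type} {s : P → ℕ} {f g : P → ℕ}

theorem mono (h : PolyBounded s g) (hle : ∀ p, f p ≤ g p) : PolyBounded s f :=
  h.imp fun _ hc p => (hle p).trans (hc p)

theorem const (s : P → ℕ) (c : ℕ) : PolyBounded s fun _ => c :=
  ⟨c, fun p => Nat.le_mul_of_pos_right _ (by positivity)⟩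

theorem of_le (h : ∀ p, f p ≤ s p) : PolyBounded s f :=
  ⟨1, fun p => by simpa using (h p).trans (Nat.le_succ _)⟩

theorem add (hf : PolyBounded s f) (hg : PolyBounded s g) : PolyBounded s fun p => f p + g p := by
  obtain ⟨a, ha⟩ := hf
  obtain ⟨b, hb⟩ := hg
  refine ⟨a + b, fun p => ?_⟩
  calc f p + g p ≤ a * (s p + 1) ^ a + b * (s p + 1) ^ b := add_le_add (ha p) (hb p)
    _ ≤ a * (s p + 1) ^ (a + b) + b * (s p + 1) ^ (a + b) := by gcongr <;> omega
    _ = (a + b) * (s p + 1) ^ (a + b) := by ring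

theorem mul (hf : PolyBounded s f) (hg : PolyBounded s g) : PolyBounded s fun p => f p * g p := by
  obtain ⟨a, ha⟩ := hf
  obtain ⟨b, hb⟩ := hg
  -- The one constant must dominate both the coefficient `a * b` and the exponent `a + b`.
  refine ⟨a * b + a + b, fun p => ?_⟩
  calc f p * g p ≤ (a * (s p + 1) ^ a) * (b * (s p + 1) ^ b) := Nat.mul_le_mul (ha p) (hb p)
    _ = (a * b) * (s p + 1) ^ (a + b) := by ring
    _ ≤ (a * b + a + b) * (s p + 1) ^ (a * b + a + b) := by gcongr <;> omega

end PolyBounded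

/-! ### Building circuits -/

namespace GateOp

variable {α β : Type}

/-- Relabelling the wires that a gate reads. -/
def map (f : α → β) : GateOp α → GateOp β
  | not a => not (f a)
  | maj k a => maj k fun i => f (a i)

theorem inputs_map (f : α → β) (o : GateOp α) : (o.map f).inputs = f '' o.inputs := by
  cases o with
  | not a => simp [map, inputs]
  | maj k a => simp [map, inputs, ← Set.range_comp, Function.comp_def]

@[simp]
theorem fanIn_map (f : α → β) (o : GateOp α) : (o.map f).fanIn = o.fanIn := by
  cases o <;> rfl

theorem eval_map (f : α → β) (o : GateOp α) (v : β → Bool) :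
    (o.map f).eval v = o.eval fun a => v (f a) := by
  cases o <;> rfl

end GateOp

namespace Circuit

variable {ι κ : Type}

theorem level_lt_depth (C : Circuit ι κ) (g : C.Gate) : C.level g < C.depth := by
  let := C.fintypeGate
  exact Finset.le_sup (f := fun g : C.Gate => C.level g + 1) (Finset.mem_univ g)

theorem depth_le (C : Circuit ι κ) {d : ℕ} (h : ∀ g, C.level g < d) : C.depth ≤ d := by
  let := C.fintypeGate
  exact Finset.sup_le fun g _ => h g

/-- The circuit without gates whose output wires are input wires. -/
def wires (f : κ → ι) : Circuit ι κ where
  Gate := Empty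
  fintypeGate := inferInstance
  op := Empty.elim
  level := Empty.elim
  level_lt := fun g => g.elim
  out := fun k => Sum.inl (f k)

/-- Parallel composition of a family of circuits with common inputs. -/
def parallel {J : Type} [Fintype J] {κ : J → Type} (C : ∀ j, Circuit ι (κ j)) :
    Circuit ι (Σ j, κ j) where
  Gate := Σ j, (C j).Gate
  fintypeGate := letI := fun j => (C j).fintypeGate; inferInstance
  op := fun g => ((C g.1).op g.2).map (Sum.map id (Sigma.mk g.1))
  level := fun g => (C g.1).level g.2
  level_lt := by
    rintro ⟨i, g⟩ ⟨j, h⟩ hh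
    rw [GateOp.inputs_map] at hh
    obtain ⟨a | a, ha, hab⟩ := hh
    · simp at hab
    · simp only [Sum.map_inr, Sum.inr.injEq, Sigma.mk.injEq] at hab
      obtain ⟨rfl, hab⟩ := hab
      obtain rfl := eq_of_heq hab
      exact (C i).level_lt _ _ ha
  out := fun k => Sum.map id (Sigma.mk k.1) ((C k.1).out k.2)

section parallel

variable {J : Type} [Fintype J] {κ : J → Type} (C : ∀ j, Circuit ι (κ j))

theorem gateVal_parallel (x : ι → Bool) (j : J) (g : (C j).Gate) :
    (parallel C).gateVal x ⟨j, g⟩ = (C j).gateVal x g := by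
  induction hn : (C j).level g using Nat.strong_induction_on generalizing g with
  | _ n ih =>
    refine (gateVal_eq (parallel C) x _).trans (Eq.trans ?_ (gateVal_eq (C j) x g).symm)
    refine (GateOp.eval_map _ _ _).trans (GateOp.eval_congr _ ?_)
    rintro (a | a) ha
    · rfl
    · exact ih _ (hn ▸ (C j).level_lt _ _ ha) a rfl

theorem eval_parallel (x : ι → Bool) (j : J) (k : κ j) :
    (parallel C).eval x ⟨j, k⟩ = (C j).eval x k := by
  have h : (parallel C).out ⟨j, k⟩ = Sum.map id (Sigma.mk j) ((C j).out k) := rfl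
  rw [eval, eval, h]
  cases (C j).out k with
  | inl i => rfl
  | inr g => exact gateVal_parallel C x j g

theorem size_parallel : (parallel C).size = ∑ j, (C j).size := by
  let := fun j => (C j).fintypeGate
  have h : (parallel C).size = ∑ g : (Σ j, (C j).Gate), (1 + ((C g.1).op g.2).fanIn) := by
    unfold size parallel
    simp
  rw [h, Fintype.sum_sigma]
  rfl

theorem depth_parallel_le {d : ℕ} (h : ∀ j, (C j).depth ≤ d) : (parallel C).depth ≤ d :=
  depth_le _ fun g => ((C g.1).level_lt_depth g.2).trans_le (h g.1)

end parallel

/-- Adding one gate that reads output wires. -/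
def addGate (C : Circuit ι κ) (o : GateOp κ) : Circuit ι Unit where
  Gate := Option C.Gate
  fintypeGate := letI := C.fintypeGate; inferInstance
  op := fun g => g.elim (o.map fun k => Sum.map id some (C.out k))
    fun g => (C.op g).map (Sum.map id some)
  level := fun g => g.elim C.depth C.level
  level_lt := by
    rintro (_ | g) h hh
    · simp only [Option.elim_none, GateOp.inputs_map] at hh
      obtain ⟨k, -, hab⟩ := hh
      cases hk : C.out k with
      | inl i => simp [hk] at hab
      | inr g =>
        simp only [hk, Sum.map_inr, Sum.inr.injEq] at hab
        subst hab
        exact C.level_lt_depth g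
    · simp only [Option.elim_some, GateOp.inputs_map] at hh
      obtain ⟨a | a, ha, hab⟩ := hh
      · simp at hab
      · simp only [Sum.map_inr, Sum.inr.injEq] at hab
        subst hab
        exact C.level_lt _ _ ha
  out := fun _ => Sum.inr none

theorem gateVal_addGate_some (C : Circuit ι κ) (o : GateOp κ) (x : ι → Bool) (g : C.Gate) :
    (C.addGate o).gateVal x (some g) = C.gateVal x g := by
  induction hn : C.level g using Nat.strong_induction_on generalizing g with
  | _ n ih =>
    refine (gateVal_eq (C.addGate o) x _).trans (Eq.trans ?_ (gateVal_eq C x g).symm)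
    refine (GateOp.eval_map _ _ _).trans (GateOp.eval_congr _ ?_)
    rintro (a | a) ha
    · rfl
    · exact ih _ (hn ▸ C.level_lt _ _ ha) a rfl

theorem eval_addGate (C : Circuit ι κ) (o : GateOp κ) (x : ι → Bool) :
    (C.addGate o).eval x () = o.eval (C.eval x) := by
  refine (gateVal_eq (C.addGate o) x _).trans ((GateOp.eval_map _ _ _).trans ?_)
  refine GateOp.eval_congr _ fun k _ => ?_
  rw [eval]
  cases C.out k with
  | inl i => rfl
  | inr g => exact gateVal_addGate_some C o x g

theorem size_addGate (C : Circuit ι κ) (o : GateOp κ) :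
    (C.addGate o).size = 1 + o.fanIn + C.size := by
  let := C.fintypeGate
  have h : (C.addGate o).size = ∑ g : Option C.Gate,
      (1 + (g.elim (o.map fun k => Sum.map id some (C.out k))
        fun g => (C.op g).map (Sum.map id some) : GateOp (ι ⊕ Option C.Gate)).fanIn) := rfl
  rw [h, Fintype.sum_option]
  simp [size]

theorem depth_addGate_le (C : Circuit ι κ) (o : GateOp κ) :
    (C.addGate o).depth ≤ C.depth + 1 := by
  refine depth_le _ ?_
  rintro (_ | g)
  · exact Nat.lt_succ_self _
  · exact (C.level_lt_depth g).trans (Nat.lt_succ_self _)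

end Circuit

/-! ### Formulas -/

/-- Threshold formulas: tree-like circuits of `MAJORITY` and negation gates. -/
inductive Formula (ι : Type) : Type
  | var (i : ι) : Formula ι
  | not (φ : Formula ι) : Formula ι
  | maj (k : ℕ) (φ : Fin k → Formula ι) : Formula ι

namespace Formula

variable {ι : Type}

/-- The value of a formula. -/
def eval (x : ι → Bool) : Formula ι → Bool
  | var i => x i
  | not φ => !φ.eval x
  | maj k φ => decide (k ≤ 2 * (Finset.univ.filter fun i => (φ i).eval x = true).card)

/-- The depth of a formula. -/
def depth : Formula ι → ℕ
  | var _ => 0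
  | not φ => φ.depth + 1
  | maj _ φ => (Finset.univ.sup fun i => (φ i).depth) + 1

/-- The number of gates and wires of a formula. -/
def size : Formula ι → ℕ
  | var _ => 0
  | not φ => 2 + φ.size
  | maj k φ => 1 + k + ∑ i, (φ i).size

/-- Subformulas are placed side by side without sharing and joined by one new gate, so size and
depth follow the recursion of the formula. Working with trees is no loss here, because all formulas
below have constant depth and polynomial size. -/
theorem exists_circuit (φ : Formula ι) : ∃ C : Circuit ι Unit,
    C.size ≤ φ.size ∧ C.depth ≤ φ.depth ∧ ∀ x, C.eval x () = φ.eval x := by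
  induction φ with
  | var i =>
    refine ⟨Circuit.wires fun _ => i, ?_, ?_, fun x => rfl⟩
    · exact le_of_eq (Finset.sum_of_isEmpty (ι := Empty) _)
    · exact Circuit.depth_le _ fun g => g.elim
  | not φ ih =>
    obtain ⟨C, hs, hd, he⟩ := ih
    refine ⟨C.addGate (GateOp.not ()), ?_, ?_, fun x => ?_⟩
    · rw [Circuit.size_addGate]
      simpa [GateOp.fanIn, size] using hs
    · exact (Circuit.depth_addGate_le _ _).trans (Nat.succ_le_succ hd)
    · rw [Circuit.eval_addGate]
      simp [GateOp.eval, eval, he]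
  | maj k φ ih =>
    choose C hs hd he using ih
    refine ⟨(Circuit.parallel C).addGate (GateOp.maj k fun i => ⟨i, ()⟩), ?_, ?_, fun x => ?_⟩
    · rw [Circuit.size_addGate, Circuit.size_parallel]
      exact Nat.add_le_add_left (Finset.sum_le_sum fun i _ => hs i) _
    · exact (Circuit.depth_addGate_le _ _).trans (Nat.succ_le_succ
        (Circuit.depth_parallel_le C fun j => (hd j).trans
          (Finset.le_sup (f := fun i => (φ i).depth) (Finset.mem_univ j))))
    · rw [Circuit.eval_addGate]
      simp [GateOp.eval, eval, Circuit.eval_parallel, he]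

end Formula

/-! ### Predicates decided by threshold formulas of constant depth and polynomial size -/

/-- A family of predicates on bit strings (for every parameter `p` an arbitrary set `κ p` of
predicates) that is decided by formulas of constant depth and of size polynomial in `s p`. -/
def InTC0 {P : Type} (s : P → ℕ) {ι κ : P → Type} (f : ∀ p, κ p → (ι p → Bool) → Prop) : Prop :=
  ∃ (d : ℕ) (S : P → ℕ), PolyBounded s S ∧ ∀ p k, ∃ φ : Formula (ι p),
    φ.depth ≤ d ∧ φ.size ≤ S p ∧ ∀ x, φ.eval x = true ↔ f p k x

theorem InTC0.exists_circuit {P : Type} {s : P → ℕ} {ι κ : P → Type} [∀ p, Fintype (κ p)]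
    {f : ∀ p, κ p → (ι p → Bool) → Prop} (h : InTC0 s f)
    (hκ : PolyBounded s fun p => Fintype.card (κ p)) :
    ∃ C : ∀ p, Circuit (ι p) (κ p), IsTC0 s C ∧ ∀ p x k, (C p).eval x k = true ↔ f p k x := by
  obtain ⟨d, S, hS, h⟩ := h
  choose φ hd hs he using h
  choose C hCs hCd hCe using fun p k => (φ p k).exists_circuit
  -- The parallel composition has outputs `⟨k, ()⟩`; only the output map is changed, so gate values
  -- stay the same.
  refine ⟨fun p => { Circuit.parallel (C p) with
    out := fun k => (Circuit.parallel (C p)).out ⟨k, ()⟩ },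
    ⟨⟨d, fun p => Circuit.depth_parallel_le (C p) fun k => (hCd p k).trans (hd p k)⟩,
      (hκ.mul hS).mono fun p => ?_⟩, fun p x k => ?_⟩
  · refine (Circuit.size_parallel (C p)).le.trans ?_
    refine (Finset.sum_le_card_nsmul _ _ (S p) fun k _ => (hCs p k).trans (hs p k)).trans ?_
    simp
  · rw [← he, ← hCe, ← Circuit.eval_parallel (C p)]
    have h : ∀ g, Circuit.gateVal { Circuit.parallel (C p) with
        out := fun k => (Circuit.parallel (C p)).out ⟨k, ()⟩ } x g =
          (Circuit.parallel (C p)).gateVal x g := by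
      intro g
      induction hn : (Circuit.parallel (C p)).level g using Nat.strong_induction_on
        generalizing g with
      | _ n ih =>
        rw [Circuit.gateVal_eq, Circuit.gateVal_eq]
        apply GateOp.eval_congr
        rintro (a | a) ha
        · rfl
        · exact ih _ (hn ▸ (Circuit.parallel (C p)).level_lt _ _ ha) a rfl
    simp only [Circuit.eval]
    cases (Circuit.parallel (C p)).out ⟨k, ()⟩ with
    | inl i => rfl
    | inr g => simp [h]

namespace InTC0

variable {P : Type} {s : P → ℕ} {ι κ : P → Type} {f g : ∀ p, κ p → (ι p → Bool) → Prop}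

theorem congr (hf : InTC0 s f) (h : ∀ p k x, f p k x ↔ g p k x) : InTC0 s g := by
  have : f = g := by
    funext p k x
    exact propext (h p k x)
  exact this ▸ hf

/-- Depth and size bounds are uniform in the index and families are non-uniform, so the map of
indices may be arbitrary and costs nothing. -/
theorem reindex {κ' : P → Type} (hf : InTC0 s f) (e : ∀ p, κ' p → κ p) :
    InTC0 s fun p k x => f p (e p k) x := by
  obtain ⟨d, S, hS, h⟩ := hf
  exact ⟨d, S, hS, fun p k => h p (e p k)⟩

theorem var (s : P → ℕ) (e : ∀ p, κ p → ι p) : InTC0 s fun p k x => x (e p k) = true :=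
  ⟨0, fun _ => 0, .const _ _, fun p k => ⟨.var (e p k), le_rfl, le_rfl, fun _ => Iff.rfl⟩⟩

theorem not (hf : InTC0 s f) : InTC0 s fun p k x => ¬f p k x := by
  obtain ⟨d, S, hS, h⟩ := hf
  refine ⟨d + 1, fun p => 2 + S p, (PolyBounded.const _ _).add hS, fun p k => ?_⟩
  obtain ⟨φ, hd, hs, he⟩ := h p k
  refine ⟨.not φ, Nat.succ_le_succ hd, Nat.add_le_add_left hs 2, fun x => ?_⟩
  simp [Formula.eval, ← he]

theorem const (s : P → ℕ) (c : ∀ p, κ p → Prop) :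
    InTC0 (ι := ι) s fun p k _ => c p k := by
  -- `MAJORITY` of no inputs is true since `0 ≤ 0`; its negation is the constant false.
  have h (p) : ∃ φ : Formula (ι p), φ.depth ≤ 2 ∧ φ.size ≤ 3 ∧ ∀ x, φ.eval x = true :=
    ⟨.maj 0 Fin.elim0, by simp [Formula.depth], by simp [Formula.size], by simp [Formula.eval]⟩
  have h' (p) : ∃ φ : Formula (ι p), φ.depth ≤ 2 ∧ φ.size ≤ 3 ∧ ∀ x, φ.eval x = false :=
    ⟨.not (.maj 0 Fin.elim0), by simp [Formula.depth], by simp [Formula.size],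
      by simp [Formula.eval]⟩
  refine ⟨2, fun _ => 3, .const _ _, fun p k => ?_⟩
  by_cases hc : c p k
  · exact (h p).imp fun φ hφ => ⟨hφ.1, hφ.2.1, by simp [hφ.2.2, hc]⟩
  · exact (h' p).imp fun φ hφ => ⟨hφ.1, hφ.2.1, by simp [hφ.2.2, hc]⟩

open Classical in
/-- Threshold gates with polynomially many inputs. -/
theorem count {J : P → Type} [∀ p, Fintype (J p)] {f : ∀ p, κ p × J p → (ι p → Bool) → Prop}
    (hf : InTC0 s f) (hJ : PolyBounded s fun p => Fintype.card (J p)) (v : ∀ p, κ p → ℕ) :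
    InTC0 s fun p k x => v p k ≤ (Finset.univ.filter fun j => f p (k, j) x).card := by
  obtain ⟨d, S, hS, h⟩ := hf
  choose φ hd hs he using h
  refine ⟨d + 3, fun p => 3 + (4 * Fintype.card (J p)) * (1 + (S p + 3)),
    (PolyBounded.const _ _).add (((PolyBounded.const _ _).mul hJ).mul
      ((PolyBounded.const _ _).add (hS.add (PolyBounded.const _ _)))), fun p k => ?_⟩
  have hT : ∃ φ : Formula (ι p), φ.depth ≤ 2 ∧ φ.size ≤ 3 ∧ ∀ x, φ.eval x = true :=
    ⟨.maj 0 Fin.elim0, by simp [Formula.depth], by simp [Formula.size], by simp [Formula.eval]⟩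
  have hF : ∃ φ : Formula (ι p), φ.depth ≤ 2 ∧ φ.size ≤ 3 ∧ ∀ x, φ.eval x = false :=
    ⟨.not (.maj 0 Fin.elim0), by simp [Formula.depth], by simp [Formula.size],
      by simp [Formula.eval]⟩
  obtain ⟨T, hTd, hTs, hTe⟩ := hT
  obtain ⟨F, hFd, hFs, hFe⟩ := hF
  by_cases hv : v p k ≤ Fintype.card (J p)
  -- Padding with `|J|` true and `2 v` false inputs makes `2 |J| + 2 v` inputs, of which `count +
  -- |J|` are true: a majority exactly if `v ≤ count`.
  · let I : Type := J p ⊕ (J p ⊕ Fin (2 * v p k))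
    let ψ : I → Formula (ι p) := Sum.elim (fun j => φ p (k, j)) (Sum.elim (fun _ => T) fun _ => F)
    let e : Fin (Fintype.card I) ≃ I := (Fintype.equivFin I).symm
    have hψd (i) : (ψ i).depth ≤ d + 2 := by
      rcases i with j | j | j <;> simp only [ψ, Sum.elim_inl, Sum.elim_inr]
      · exact (hd _ _).trans (by omega)
      · exact hTd.trans (by omega)
      · exact hFd.trans (by omega)
    have hψs (i) : (ψ i).size ≤ S p + 3 := by
      rcases i with j | j | j <;> simp only [ψ, Sum.elim_inl, Sum.elim_inr]
      · exact (hs _ _).trans (by omega)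
      · exact hTs.trans (by omega)
      · exact hFs.trans (by omega)
    have hI : Fintype.card I = 2 * Fintype.card (J p) + 2 * v p k := by
      simp only [I, Fintype.card_sum, Fintype.card_fin]
      ring
    refine ⟨.maj (Fintype.card I) fun i => ψ (e i), ?_, ?_, fun x => ?_⟩
    · exact Nat.succ_le_succ (Finset.sup_le fun i _ => hψd _)
    · have h1 : ∑ i, (ψ (e i)).size ≤ Fintype.card I * (S p + 3) := by
        refine (Finset.sum_le_card_nsmul _ _ (S p + 3) fun i _ => hψs _).trans ?_
        simp
      have h2 : Fintype.card I ≤ 4 * Fintype.card (J p) := by omega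
      simp only [Formula.size]
      nlinarith [Nat.mul_le_mul_right (1 + (S p + 3)) h2]
    · have hc : (Finset.univ.filter fun i => (ψ (e i)).eval x = true).card =
          (Finset.univ.filter fun j => f p (k, j) x).card + Fintype.card (J p) := by
        rw [← Fintype.card_subtype, Fintype.card_congr (e.subtypeEquiv (q := fun i =>
          (ψ i).eval x = true) fun _ => Iff.rfl), Fintype.card_subtype,
          Finset.card_filter, Fintype.sum_sum_type, Fintype.sum_sum_type, Finset.card_filter]
        simp [ψ, he, hTe, hFe]
      simp only [Formula.eval, hc, decide_eq_true_eq]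
      omega
  -- A threshold above the number of inputs is never reached; separating this case keeps the padding
  -- polynomial.
  · refine ⟨F, hFd.trans (by omega), hFs.trans (Nat.le_add_right _ _), fun x => ?_⟩
    have := Finset.card_le_univ (Finset.univ.filter fun j => f p (k, j) x)
    rw [hFe]
    simp only [Bool.false_eq_true, false_iff, not_le]
    omega

section

variable {J : P → Type} [∀ p, Fintype (J p)] {f : ∀ p, κ p × J p → (ι p → Bool) → Prop}

theorem ex (hf : InTC0 s f) (hJ : PolyBounded s fun p => Fintype.card (J p)) :
    InTC0 s fun p k x => ∃ j, f p (k, j) x := by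
  classical
  refine (hf.count hJ fun _ _ => 1).congr fun p k x => ?_
  simp [Nat.one_le_iff_ne_zero, Finset.filter_eq_empty_iff]

theorem all (hf : InTC0 s f) (hJ : PolyBounded s fun p => Fintype.card (J p)) :
    InTC0 s fun p k x => ∀ j, f p (k, j) x :=
  (hf.not.ex hJ).not.congr fun p k x => by simp

end

theorem and (hf : InTC0 s f) (hg : InTC0 s g) : InTC0 s fun p k x => f p k x ∧ g p k x := by
  have h : InTC0 s fun p (k : κ p × Bool) x => if k.2 then f p k.1 x else g p k.1 x := by
    obtain ⟨d, S, hS, h⟩ := hf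
    obtain ⟨d', S', hS', h'⟩ := hg
    refine ⟨d + d', fun p => S p + S' p, hS.add hS', ?_⟩
    rintro p ⟨k, _ | _⟩
    · exact (h' p k).imp fun φ h => ⟨h.1.trans (by omega), h.2.1.trans (by simp),
        by simpa using h.2.2⟩
    · exact (h p k).imp fun φ h => ⟨h.1.trans (by omega), h.2.1.trans (by simp),
        by simpa using h.2.2⟩
  refine (h.all (.const _ 2)).congr fun p k x => ?_
  simp [and_comm]

theorem or (hf : InTC0 s f) (hg : InTC0 s g) : InTC0 s fun p k x => f p k x ∨ g p k x :=
  (hf.not.and hg.not).not.congr fun p k x => by tauto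

theorem iff (hf : InTC0 s f) (hg : InTC0 s g) : InTC0 s fun p k x => (f p k x ↔ g p k x) :=
  ((hf.and hg).or (hf.not.and hg.not)).congr fun p k x => by tauto

theorem ite (hf : InTC0 s f) {g' : ∀ p, κ p → (ι p → Bool) → Prop} (hg : InTC0 s g)
    (hg' : InTC0 s g') :
    InTC0 s fun p k x => (f p k x → g p k x) ∧ (¬f p k x → g' p k x) :=
  ((hf.not.or hg).and (hf.or hg')).congr fun p k x => by tauto

/-- A family indexed by a sum type, given on both summands. -/
theorem sumElim {κ' : P → Type} {f : ∀ p, κ p ⊕ κ' p → (ι p → Bool) → Prop}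
    (h : InTC0 s fun p k x => f p (Sum.inl k) x) (h' : InTC0 s fun p k x => f p (Sum.inr k) x) :
    InTC0 s f := by
  obtain ⟨d, S, hS, h⟩ := h
  obtain ⟨d', S', hS', h'⟩ := h'
  refine ⟨d + d', fun p => S p + S' p, hS.add hS', ?_⟩
  rintro p (k | k)
  · exact (h p k).imp fun φ h => ⟨h.1.trans (by omega), h.2.1.trans (by simp), h.2.2⟩
  · exact (h' p k).imp fun φ h => ⟨h.1.trans (by omega), h.2.1.trans (by simp), h.2.2⟩

open Classical in
/-- Any property of a sum of polynomially many bits with polynomially bounded weights. -/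
theorem weightedSum {J : P → Type} [∀ p, Fintype (J p)]
    {f : ∀ p, κ p × J p → (ι p → Bool) → Prop} (hf : InTC0 s f)
    (hJ : PolyBounded s fun p => Fintype.card (J p)) {B : P → ℕ} (hB : PolyBounded s B)
    (wt : ∀ p, κ p → J p → ℕ) (hwt : ∀ p k j, wt p k j ≤ B p) (Q : ∀ p, κ p → ℕ → Prop) :
    InTC0 s fun p k x => Q p k (∑ j, if f p (k, j) x then wt p k j else 0) := by
  -- Weights are written in unary: the bit `j` is counted once for every number below its weight.
  have h1 : InTC0 s fun p (k : (κ p × ℕ) × (J p × Fin (B p))) x =>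
      f p (k.1.1, k.2.1) x ∧ (k.2.2 : ℕ) < wt p k.1.1 k.2.1 :=
    (hf.reindex fun p (k : (κ p × ℕ) × (J p × Fin (B p))) => (k.1.1, k.2.1)).and (const _ _)
  have hcard : PolyBounded s fun p => Fintype.card (J p × Fin (B p)) := by
    simpa using hJ.mul hB
  have h2 := h1.count hcard fun p (k : κ p × ℕ) => k.2
  have hsum (p k x) : (Finset.univ.filter fun j : J p × Fin (B p) =>
      f p (k, j.1) x ∧ (j.2 : ℕ) < wt p k j.1).card =
        ∑ j, if f p (k, j) x then wt p k j else 0 := by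
    rw [Finset.card_filter, Fintype.sum_prod_type]
    refine Finset.sum_congr rfl fun j _ => ?_
    by_cases hj : f p (k, j) x
    · simp only [hj, true_and, if_true]
      rw [← Finset.card_filter, Fin.card_filter_val_lt, min_eq_right (hwt p k j)]
    · simp [hj]
  simp only [hsum] at h2
  -- The exact value of the sum is guessed among polynomially many and pinned between two
  -- thresholds; `Q` is then a constant of the formula.
  have h3 : InTC0 s fun p (k : κ p × Fin (Fintype.card (J p) * B p + 1)) x =>
      ((k.2 : ℕ) ≤ (∑ j, if f p (k.1, j) x then wt p k.1 j else 0) ∧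
        ¬((k.2 : ℕ) + 1 ≤ ∑ j, if f p (k.1, j) x then wt p k.1 j else 0)) ∧ Q p k.1 k.2 :=
    ((h2.reindex fun p (k : κ p × Fin (Fintype.card (J p) * B p + 1)) => (k.1, (k.2 : ℕ))).and
      (h2.reindex fun p (k : κ p × Fin (Fintype.card (J p) * B p + 1)) =>
        (k.1, (k.2 : ℕ) + 1)).not).and (const _ _)
  refine (h3.ex ?_).congr fun p k x => ?_
  · simpa using (hJ.mul hB).add (.const _ 1)
  · constructor
    · rintro ⟨v, ⟨hv, hv'⟩, hQ⟩
      dsimp only at hv hv' hQ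
      rwa [show (∑ j, if f p (k, j) x then wt p k j else 0) = v by omega]
    · intro hQ
      have hle : (∑ j, if f p (k, j) x then wt p k j else 0) ≤ Fintype.card (J p) * B p := by
        refine (Finset.sum_le_card_nsmul _ _ (B p) fun j _ => ?_).trans (by simp)
        split_ifs
        · exact hwt p k j
        · exact Nat.zero_le _
      exact ⟨⟨_, Nat.lt_succ_of_le hle⟩, ⟨le_rfl, by simp⟩, hQ⟩

end InTC0

/-! ### Bits of sums -/

theorem natVal_eq_ofBits {w : ℕ} (u : Fin w → Bool) : natVal u = Nat.ofBits u := by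
  induction w with
  | zero => rfl
  | succ w ih =>
    rw [Nat.ofBits_succ, ← ih, natVal, Fin.sum_univ_succ, natVal, Finset.mul_sum, add_comm]
    congr 1
    · refine Finset.sum_congr rfl fun i _ => ?_
      simp [pow_succ']
    · cases u 0 <;> simp

theorem natVal_lt {w : ℕ} (u : Fin w → Bool) : natVal u < 2 ^ w :=
  natVal_eq_ofBits u ▸ Nat.ofBits_lt_two_pow u

theorem testBit_natVal {w : ℕ} (u : Fin w → Bool) (t : ℕ) :
    (natVal u).testBit t = if h : t < w then u ⟨t, h⟩ else false := by
  rw [natVal_eq_ofBits, Nat.testBit_ofBits]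

theorem natVal_testBit {w a : ℕ} (h : a < 2 ^ w) :
    natVal (fun t : Fin w => a.testBit t) = a := by
  apply Nat.eq_of_testBit_eq
  intro t
  rw [testBit_natVal]
  split_ifs with ht
  · rfl
  · exact (Nat.testBit_lt_two_pow (h.trans_le (Nat.pow_le_pow_right two_pos (not_lt.1 ht)))).symm

/-- A carry arrives at `i` if some lower position generates it and all positions in between
propagate it. Unlike the recursion for carries, this has constant depth. -/
theorem carry_iff {w : ℕ} (x y : BitVec w) (i : ℕ) :
    BitVec.carry i x y false = true ↔ ∃ j < i, (x.getLsbD j = true ∧ y.getLsbD j = true) ∧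
      ∀ l, j < l → l < i → x.getLsbD l = true ∨ y.getLsbD l = true := by
  induction i with
  | zero => simp [BitVec.carry, Nat.mod_one]
  | succ i ih =>
    have h : BitVec.carry (i + 1) x y false = true ↔
        (x.getLsbD i = true ∧ y.getLsbD i = true) ∨
          ((x.getLsbD i = true ∨ y.getLsbD i = true) ∧ BitVec.carry i x y false = true) := by
      rw [BitVec.carry_succ]
      cases x.getLsbD i <;> cases y.getLsbD i <;> cases BitVec.carry i x y false <;> decide
    rw [h, ih]
    constructor
    · rintro (h | ⟨h, j, hj, hxy, hl⟩)
      · exact ⟨i, Nat.lt_succ_self i, h, fun l h1 h2 => by omega⟩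
      · refine ⟨j, by omega, hxy, fun l h1 h2 => ?_⟩
        rcases Nat.lt_succ_iff_lt_or_eq.1 h2 with h2 | rfl
        · exact hl l h1 h2
        · exact h
    · rintro ⟨j, hj, hxy, hl⟩
      rcases Nat.lt_succ_iff_lt_or_eq.1 hj with hj | rfl
      · exact Or.inr ⟨hl i hj (Nat.lt_succ_self i), j, hj, hxy, fun l h1 h2 => hl l h1 (by omega)⟩
      · exact Or.inl hxy

/-- Carry look-ahead addition. -/
theorem testBit_add_iff (a b t : ℕ) : (a + b).testBit t = true ↔
    ((a.testBit t = true ↔ b.testBit t = true) ↔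
      ∃ j < t, (a.testBit j = true ∧ b.testBit j = true) ∧
        ∀ l, j < l → l < t → a.testBit l = true ∨ b.testBit l = true) := by
  -- Width `t + 1` suffices for bit `t`. The iterated equivalence in the statement is the exclusive
  -- or of the two bits and the carry.
  have h := BitVec.getLsbD_add (i := t) (Nat.lt_succ_self t) (BitVec.ofNat (t + 1) a)
    (BitVec.ofNat (t + 1) b)
  have hg (c l : ℕ) (hl : l ≤ t) : (BitVec.ofNat (t + 1) c).getLsbD l = c.testBit l := by
    rw [BitVec.getLsbD_ofNat]
    simp [Nat.lt_succ_iff.2 hl]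
  have hc := carry_iff (BitVec.ofNat (t + 1) a) (BitVec.ofNat (t + 1) b) t
  have hc' : BitVec.carry t (BitVec.ofNat (t + 1) a) (BitVec.ofNat (t + 1) b) false = true ↔
      ∃ j < t, (a.testBit j = true ∧ b.testBit j = true) ∧
        ∀ l, j < l → l < t → a.testBit l = true ∨ b.testBit l = true := by
    rw [hc]
    refine exists_congr fun j => and_congr_right fun hj => ?_
    rw [hg _ _ hj.le, hg _ _ hj.le]
    refine and_congr_right fun _ => forall_congr' fun l => forall_congr' fun _ =>
      forall_congr' fun hl => ?_
    rw [hg _ _ hl.le, hg _ _ hl.le]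
  rw [← hc', ← hg (a + b) t le_rfl, BitVec.ofNat_add, h, hg _ _ le_rfl, hg _ _ le_rfl]
  cases a.testBit t <;> cases b.testBit t <;>
    cases BitVec.carry t (BitVec.ofNat (t + 1) a) (BitVec.ofNat (t + 1) b) false <;> simp

open Classical in
/-- The binary representation of a number is the concatenation of its digits in base `2 ^ L`. -/
theorem testBit_sum_block {J : Type} [Fintype J] {L : ℕ} (hL : 0 < L) (r : J → ℕ) (t : ℕ) :
    ∀ (u : J → ℕ) (g : J → Prop),
    (∀ v, ∑ j, (if g j ∧ u j = v then 2 ^ r j else 0) < 2 ^ L) →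
    (∑ j, if g j then 2 ^ (L * u j + r j) else 0).testBit t =
      (∑ j, if g j ∧ u j = t / L then 2 ^ r j else 0).testBit (t % L) := by
  induction t using Nat.strong_induction_on with
  | _ t ih =>
    intro u g hD
    -- Split off the lowest digit, formed by the terms with `u j = 0`; the rest is divisible by `2 ^
    -- L`, and the induction continues at `t - L`.
    have hS : (∑ j, if g j then 2 ^ (L * u j + r j) else 0) =
        2 ^ L * (∑ j, if g j ∧ u j ≠ 0 then 2 ^ (L * (u j - 1) + r j) else 0) +
          ∑ j, if g j ∧ u j = 0 then 2 ^ r j else 0 := by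
      rw [Finset.mul_sum, ← Finset.sum_add_distrib]
      refine Finset.sum_congr rfl fun j _ => ?_
      by_cases hg : g j
      · rcases hu : u j with _ | n
        · simp [hg]
        · simp only [hg, true_and, if_true, ne_eq, Nat.add_eq_zero_iff, one_ne_zero, and_false,
            not_false_eq_true, if_false, add_zero, Nat.add_sub_cancel, ← pow_add]
          congr 1
          ring
      · simp [hg]
    rw [hS, Nat.testBit_two_pow_mul_add _ (hD 0)]
    split_ifs with ht
    · rw [Nat.div_eq_of_lt ht, Nat.mod_eq_of_lt ht]
    · have hLt : L ≤ t := not_lt.1 ht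
      have hdiv : t / L = (t - L) / L + 1 := by
        rw [← Nat.add_div_right _ hL, Nat.sub_add_cancel hLt]
      have hiff (v : ℕ) (j : J) : ((g j ∧ u j ≠ 0) ∧ u j - 1 = v) ↔ g j ∧ u j = v + 1 := by
        constructor
        · rintro ⟨⟨h1, h2⟩, h3⟩
          exact ⟨h1, by omega⟩
        · rintro ⟨h1, h2⟩
          exact ⟨⟨h1, by omega⟩, by omega⟩
      have h := ih (t - L) (by omega) (fun j => u j - 1) (fun j => g j ∧ u j ≠ 0)
      simp only [hiff, ← Nat.mod_eq_sub_mod hLt, ← hdiv] at h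
      rw [← h fun v => hD (v + 1)]
      congr!

/-! ### Families of numbers computed by threshold formulas -/

/-- A family of natural numbers whose bits are decided by formulas of constant depth and
polynomial size. -/
def TC0Nat {P : Type} (s : P → ℕ) {ι κ : P → Type} (a : ∀ p, κ p → (ι p → Bool) → ℕ) : Prop :=
  InTC0 s fun p (k : κ p × ℕ) x => (a p k.1 x).testBit k.2 = true

namespace TC0Nat

variable {P : Type} {s : P → ℕ} {ι κ : P → Type} {a b : ∀ p, κ p → (ι p → Bool) → ℕ}

theorem congr (ha : TC0Nat s a) (h : ∀ p k x, a p k x = b p k x) : TC0Nat s b :=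
  InTC0.congr ha fun p k x => by rw [h]

theorem reindex {κ' : P → Type} (ha : TC0Nat s a) (e : ∀ p, κ' p → κ p) :
    TC0Nat s fun p k x => a p (e p k) x :=
  InTC0.reindex ha fun p (k : κ' p × ℕ) => (e p k.1, k.2)

theorem bit (ha : TC0Nat s a) (t : ∀ p, κ p → ℕ) :
    InTC0 s fun p k x => (a p k x).testBit (t p k) = true :=
  InTC0.reindex ha fun p k => (k, t p k)

theorem const (s : P → ℕ) (c : ∀ p, κ p → ℕ) : TC0Nat (ι := ι) s fun p k _ => c p k :=
  InTC0.const s _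

theorem ofBits (s : P → ℕ) {w : P → ℕ} (e : ∀ p, κ p → Fin (w p) → ι p) :
    TC0Nat s fun p k x => natVal fun t => x (e p k t) := by
  refine ⟨2, fun _ => 3, .const _ _, ?_⟩
  rintro p ⟨k, t⟩
  by_cases ht : t < w p
  · exact ⟨.var (e p k ⟨t, ht⟩), Nat.zero_le _, Nat.zero_le _, fun x => by
      simp [testBit_natVal, ht, Formula.eval]⟩
  · exact ⟨.not (.maj 0 Fin.elim0), by simp [Formula.depth], by simp [Formula.size], fun x => by
      simp [testBit_natVal, ht, Formula.eval]⟩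

theorem sumElim {κ' : P → Type} {b : ∀ p, κ' p → (ι p → Bool) → ℕ} (ha : TC0Nat s a)
    (hb : TC0Nat s b) : TC0Nat s fun p k => Sum.elim (a p) (b p) k := by
  refine ((InTC0.sumElim (f := fun p => Sum.elim (fun (k : κ p × ℕ) x =>
    (a p k.1 x).testBit k.2 = true) fun (k : κ' p × ℕ) x => (b p k.1 x).testBit k.2 = true)
      ha hb).reindex
      fun p (k : (κ p ⊕ κ' p) × ℕ) => k.1.elim (fun i => Sum.inl (i, k.2))
        fun i => Sum.inr (i, k.2)).congr ?_
  rintro p ⟨k | k, t⟩ x <;> rfl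

open Classical in
theorem ite {f : ∀ p, κ p → (ι p → Bool) → Prop} (hf : InTC0 s f) (ha : TC0Nat s a)
    (hb : TC0Nat s b) : TC0Nat s fun p k x => if f p k x then a p k x else b p k x :=
  (InTC0.ite (hf.reindex fun p (k : κ p × ℕ) => k.1) ha hb).congr fun p k x => by
    by_cases h : f p k.1 x <;> simp [h]

theorem two_pow_mul (ha : TC0Nat s a) (K : P → ℕ) : TC0Nat s fun p k x => 2 ^ K p * a p k x :=
  ((InTC0.const s fun p (k : κ p × ℕ) => K p ≤ k.2).and
    (InTC0.reindex ha fun p (k : κ p × ℕ) => (k.1, k.2 - K p))).congr fun p k x => by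
      simp [Nat.testBit_two_pow_mul]

theorem mod_two_pow (ha : TC0Nat s a) (K : P → ℕ) : TC0Nat s fun p k x => a p k x % 2 ^ K p :=
  ((InTC0.const s fun p (k : κ p × ℕ) => k.2 < K p).and ha).congr fun p k x => by
    simp [Nat.testBit_mod_two_pow]

theorem compl (ha : TC0Nat s a) (K : P → ℕ) (hK : ∀ p k x, a p k x < 2 ^ K p) :
    TC0Nat s fun p k x => 2 ^ K p - (a p k x + 1) :=
  ((InTC0.const s fun p (k : κ p × ℕ) => k.2 < K p).and (InTC0.not ha)).congr fun p k x => by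
    simp [Nat.testBit_two_pow_sub_succ (hK p k.1 x)]

theorem add (ha : TC0Nat s a) (hb : TC0Nat s b) {W : P → ℕ} (hW : PolyBounded s W)
    (haW : ∀ p k x, a p k x < 2 ^ W p) (hbW : ∀ p k x, b p k x < 2 ^ W p) :
    TC0Nat s fun p k x => a p k x + b p k x := by
  have hab : InTC0 s fun p (k : ((κ p × ℕ) × Fin (W p + 1)) × Fin (W p + 1)) x =>
      ((k.1.2 < k.2 ∧ (k.2 : ℕ) < k.1.1.2) →
        (a p k.1.1.1 x).testBit k.2 = true ∨ (b p k.1.1.1 x).testBit k.2 = true) :=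
    ((InTC0.const s fun p (k : ((κ p × ℕ) × Fin (W p + 1)) × Fin (W p + 1)) =>
      (k.1.2 < k.2 ∧ (k.2 : ℕ) < k.1.1.2)).not.or
      ((ha.reindex fun p (k : ((κ p × ℕ) × Fin (W p + 1)) × Fin (W p + 1)) => k.1.1.1).bit
          (fun p k => k.2) |>.or
        ((hb.reindex fun p (k : ((κ p × ℕ) × Fin (W p + 1)) × Fin (W p + 1)) => k.1.1.1).bit
          (fun p k => k.2)))).congr fun p k x => by tauto
  have hcard : PolyBounded s fun p => Fintype.card (Fin (W p + 1)) := by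
    simpa using hW.add (.const _ 1)
  have hc := ((InTC0.const s fun p (k : (κ p × ℕ) × Fin (W p + 1)) => (k.2 : ℕ) < k.1.2).and
    ((((ha.reindex fun p (k : (κ p × ℕ) × Fin (W p + 1)) => k.1.1).bit
          (fun p k => k.2)).and
        ((hb.reindex fun p (k : (κ p × ℕ) × Fin (W p + 1)) => k.1.1).bit
          (fun p k => k.2))).and (hab.all hcard))).ex hcard
  -- The sum is below `2 ^ (W + 1)`, so higher bits are zero and look-ahead ranges over polynomially
  -- many positions only.
  refine ((InTC0.const s fun p (k : κ p × ℕ) => k.2 ≤ W p).and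
    ((InTC0.iff ha hb).iff hc)).congr fun p k x => ?_
  by_cases hk : k.2 ≤ W p
  · rw [testBit_add_iff]
    simp only [hk, true_and]
    refine iff_congr Iff.rfl ?_
    constructor
    · rintro ⟨j, hj, hxy, hl⟩
      exact ⟨j, hj, hxy, fun l h1 h2 => hl ⟨l, by omega⟩ ⟨h1, h2⟩⟩
    · rintro ⟨j, hj, hxy, hl⟩
      exact ⟨⟨j, by omega⟩, hj, hxy, fun l h => hl l h.1 h.2⟩
  · have h1 : a p k.1 x + b p k.1 x < 2 ^ k.2 := by
      have h2 : 2 ^ (W p + 1) ≤ 2 ^ k.2 := Nat.pow_le_pow_right two_pos (by omega)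
      have := haW p k.1 x
      have := hbW p k.1 x
      rw [pow_succ] at h2
      omega
    simp [hk, Nat.testBit_lt_two_pow h1]

/-! ### Iterated addition -/

section sum

variable {J : P → Type} [∀ p, Fintype (J p)] {f : ∀ p, κ p × J p → (ι p → Bool) → Prop}

open Classical in
-- All exponents lie in the lower halves of blocks of length `2 K`. Fewer than `2 ^ K` terms, each
-- below `2 ^ K` inside its block, cannot overflow it, so a bit of the result depends on one block,
-- whose sum has polynomially bounded weights.
theorem sum_block (hf : InTC0 s f) (hJ : PolyBounded s fun p => Fintype.card (J p)) {K : P → ℕ}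
    (hJK : ∀ p, Fintype.card (J p) < 2 ^ K p) (hK : PolyBounded s fun p => 2 ^ K p)
    (u r : ∀ p, κ p → J p → ℕ) (hr : ∀ p k j, r p k j < K p) :
    TC0Nat s fun p k x => ∑ j, if f p (k, j) x then 2 ^ (2 * K p * u p k j + r p k j) else 0 := by
  have h1 : InTC0 s fun p (k : (κ p × ℕ) × J p) x =>
      f p (k.1.1, k.2) x ∧ u p k.1.1 k.2 = k.1.2 / (2 * K p) :=
    (hf.reindex fun p (k : (κ p × ℕ) × J p) => (k.1.1, k.2)).and (InTC0.const _ _)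
  refine (h1.weightedSum hJ hK (fun p k j => 2 ^ r p k.1 j)
    (fun p k j => Nat.pow_le_pow_right two_pos (hr p k.1 j).le)
    fun p k n => n.testBit (k.2 % (2 * K p)) = true).congr fun p k x => ?_
  by_cases hne : Nonempty (J p)
  · obtain ⟨j₀⟩ := hne
    have hK0 : 0 < K p := (Nat.zero_le _).trans_lt (hr p k.1 j₀)
    rw [testBit_sum_block (by omega)]
    · congr!
    intro v
    calc _ ≤ ∑ _j : J p, 2 ^ K p := by
          refine Finset.sum_le_sum fun j _ => ?_
          split_ifs
          · exact Nat.pow_le_pow_right two_pos (hr p k.1 j).le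
          · exact Nat.zero_le _
      _ = Fintype.card (J p) * 2 ^ K p := by simp
      _ < 2 ^ K p * 2 ^ K p := Nat.mul_lt_mul_of_pos_right (hJK p) (by positivity)
      _ = 2 ^ (2 * K p) := by ring
  · rw [not_nonempty_iff] at hne
    simp

open Classical in
/-- Iterated addition of polynomially many powers of two. -/
theorem sum_two_pow (hf : InTC0 s f) (hJ : PolyBounded s fun p => Fintype.card (J p))
    (e : ∀ p, κ p → J p → ℕ) {E : P → ℕ} (hE : PolyBounded s E) (he : ∀ p k j, e p k j ≤ E p) :
    TC0Nat s fun p k x => ∑ j, if f p (k, j) x then 2 ^ e p k j else 0 := by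
  -- Large enough that `|J| < 2 ^ K`, yet `2 ^ K ≤ 2 |J| + 2` remains polynomial.
  let K : P → ℕ := fun p => Nat.log 2 (Fintype.card (J p)) + 1
  have hJK (p) : Fintype.card (J p) < 2 ^ K p := Nat.lt_pow_succ_log_self one_lt_two _
  have hK0 (p) : 0 < K p := Nat.succ_pos _
  have hK : PolyBounded s fun p => 2 ^ K p := by
    refine (((PolyBounded.const s 2).mul hJ).add (.const s 2)).mono fun p => ?_
    rcases eq_or_ne (Fintype.card (J p)) 0 with h | h
    · simp [K, h]
    · have := Nat.pow_log_le_self 2 h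
      simp only [K, pow_succ]
      omega
  have hKE : PolyBounded s fun p => K p + E p :=
    (hK.mono fun p => (Nat.lt_two_pow_self).le).add hE
  have hlt (g : ∀ p, κ p × J p → (ι p → Bool) → Prop) (p k x) :
      (∑ j, if g p (k, j) x then 2 ^ e p k j else 0) < 2 ^ (K p + E p) := by
    calc _ ≤ ∑ _j : J p, 2 ^ E p := by
          refine Finset.sum_le_sum fun j _ => ?_
          split_ifs
          · exact Nat.pow_le_pow_right two_pos (he p k j)
          · exact Nat.zero_le _
      _ = Fintype.card (J p) * 2 ^ E p := by simp
      _ < 2 ^ K p * 2 ^ E p := Nat.mul_lt_mul_of_pos_right (hJK p) (by positivity)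
      _ = 2 ^ (K p + E p) := (pow_add _ _ _).symm
  have hdiv (p k j) : e p k j = K p * (e p k j / K p) + e p k j % K p :=
    (Nat.div_add_mod _ _).symm
  -- Among the windows of `K` exponents, those of one parity are separated by gaps of length `K`, as
  -- `sum_block` needs; the odd ones are shifted by `K`. One ordinary addition joins both parts.
  have hpar (c : ℕ) (hc : c < 2) : TC0Nat s fun p k x => ∑ j,
      if f p (k, j) x ∧ e p k j / K p % 2 = c then 2 ^ e p k j else 0 := by
    have h := (sum_block (hf.and (InTC0.const s fun p k => e p k.1 k.2 / K p % 2 = c)) hJ hJK hK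
      (fun p k j => e p k j / K p / 2) (fun p k j => e p k j % K p)
      fun p k j => Nat.mod_lt _ (hK0 p)).two_pow_mul fun p => K p * c
    refine h.congr fun p k x => ?_
    rw [Finset.mul_sum]
    refine Finset.sum_congr rfl fun j _ => ?_
    split_ifs with hj
    · rw [← pow_add]
      congr 1
      conv_rhs => rw [hdiv p k j, ← Nat.div_add_mod (e p k j / K p) 2, hj.2]
      ring
    · rfl
  refine ((hpar 0 two_pos).add (hpar 1 one_lt_two) hKE
    (fun p k x => by convert hlt (fun p k x => f p k x ∧ e p k.1 k.2 / K p % 2 = 0) p k x)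
    (fun p k x => by convert hlt (fun p k x => f p k x ∧ e p k.1 k.2 / K p % 2 = 1) p k x)).congr
      fun p k x => ?_
  rw [← Finset.sum_add_distrib]
  refine Finset.sum_congr rfl fun j _ => ?_
  rcases Nat.mod_two_eq_zero_or_one (e p k j / K p) with h | h <;> simp [h]

end sum

/-- Expanding both factors in binary gives a sum of `W ^ 2` terms `2 ^ (i + j)`, each switched by
two bits. -/
theorem mul (ha : TC0Nat s a) (hb : TC0Nat s b) {W : P → ℕ} (hW : PolyBounded s W)
    (haW : ∀ p k x, a p k x < 2 ^ W p) (hbW : ∀ p k x, b p k x < 2 ^ W p) :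
    TC0Nat s fun p k x => a p k x * b p k x := by
  classical
  have h1 : InTC0 s fun p (k : κ p × (Fin (W p) × Fin (W p))) x =>
      (a p k.1 x).testBit k.2.1 = true ∧ (b p k.1 x).testBit k.2.2 = true :=
    ((ha.reindex fun p (k : κ p × (Fin (W p) × Fin (W p))) => k.1).bit fun p k => k.2.1).and
      ((hb.reindex fun p (k : κ p × (Fin (W p) × Fin (W p))) => k.1).bit fun p k => k.2.2)
  refine (sum_two_pow h1 (by simpa using hW.mul hW) (fun p k j => (j.1 : ℕ) + j.2) (hW.add hW)
    fun p k j => by omega).congr fun p k x => ?_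
  conv_rhs => rw [← natVal_testBit (haW p k x), ← natVal_testBit (hbW p k x)]
  rw [natVal, natVal, Finset.sum_mul_sum, Fintype.sum_prod_type]
  refine Finset.sum_congr rfl fun i _ => Finset.sum_congr rfl fun j _ => ?_
  cases (a p k x).testBit i <;> cases (b p k x).testBit j <;> simp [pow_add]

/-- Subtraction, with an offset that makes the result a natural number. -/
theorem two_pow_add_sub (ha : TC0Nat s a) (hb : TC0Nat s b) {W : P → ℕ} (hW : PolyBounded s W)
    (haW : ∀ p k x, a p k x < 2 ^ W p) (hbW : ∀ p k x, b p k x < 2 ^ W p) :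
    TC0Nat s fun p k x => 2 ^ W p + a p k x - b p k x := by
  -- Complementing `(2 ^ W - 1 - a) + b` in `W + 1` bits yields `2 ^ W + a - b`.
  have h1 := (ha.compl W haW).add hb hW (fun p k x => by have := haW p k x; omega) hbW
  refine (h1.compl (fun p => W p + 1) fun p k x => ?_).congr fun p k x => ?_ <;>
  · have := haW p k x
    have := hbW p k x
    rw [pow_succ]
    omega

end TC0Nat

/-! ### Signed integers -/

/-- A family of integers whose signs and whose bits are decided by formulas of constant depth
and polynomial size (the sign of zero is arbitrary). -/
def TC0Int {P : Type} (s : P → ℕ) {ι κ : P → Type} (z : ∀ p, κ p → (ι p → Bool) → ℤ) : Prop :=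
  TC0Nat s (fun p k x => (z p k x).natAbs) ∧ ∃ sg : ∀ p, κ p → (ι p → Bool) → Prop,
    InTC0 s sg ∧ ∀ p k x, (sg p k x → z p k x ≤ 0) ∧ (¬sg p k x → 0 ≤ z p k x)

namespace TC0Int

variable {P : Type} {s : P → ℕ} {ι κ : P → Type} {y z : ∀ p, κ p → (ι p → Bool) → ℤ}

theorem congr (hz : TC0Int s z) (h : ∀ p k x, z p k x = y p k x) : TC0Int s y := by
  have : z = y := by
    funext p k x
    exact h p k x
  exact this ▸ hz

theorem reindex {κ' : P → Type} (hz : TC0Int s z) (e : ∀ p, κ' p → κ p) :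
    TC0Int s fun p k x => z p (e p k) x := by
  obtain ⟨hz, sg, hs, h⟩ := hz
  exact ⟨hz.reindex e, _, hs.reindex e, fun p k => h p (e p k)⟩

theorem const (s : P → ℕ) (c : ∀ p, κ p → ℤ) : TC0Int (ι := ι) s fun p k _ => c p k :=
  ⟨.const s _, _, .const s fun p k => c p k ≤ 0, fun _ _ _ => ⟨id, fun h => (not_le.1 h).le⟩⟩

theorem natCast {a : ∀ p, κ p → (ι p → Bool) → ℕ} (ha : TC0Nat s a) :
    TC0Int s fun p k x => (a p k x : ℤ) :=
  ⟨ha.congr fun p k x => by simp, _, .const s fun _ _ => False, by simp⟩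

theorem neg (hz : TC0Int s z) : TC0Int s fun p k x => -z p k x := by
  obtain ⟨hz, sg, hs, h⟩ := hz
  refine ⟨hz.congr fun p k x => by simp, _, hs.not, fun p k x => ?_⟩
  have := h p k x
  constructor <;> intro h' <;> simp_all

theorem ofBits (s : P → ℕ) {w : P → ℕ} (e : ∀ p, κ p → IntWire (w p) → ι p) :
    TC0Int s fun p k x => intVal fun t => x (e p k t) := by
  refine ⟨(TC0Nat.ofBits s fun p k t => e p k (some t)).congr fun p k x => ?_, _,
    .var s fun p k => e p k none, fun p k x => ⟨fun h => ?_, fun h => ?_⟩⟩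
  · simp only [intVal]
    split_ifs <;> simp
  · simp [intVal, h]
  · simp [intVal, h]

theorem sumElim {κ' : P → Type} {z' : ∀ p, κ' p → (ι p → Bool) → ℤ} (hz : TC0Int s z)
    (hz' : TC0Int s z') : TC0Int s fun p k => Sum.elim (z p) (z' p) k := by
  obtain ⟨hz, sg, hs, h⟩ := hz
  obtain ⟨hz', sg', hs', h'⟩ := hz'
  refine ⟨(hz.sumElim hz').congr ?_, fun p => Sum.elim (sg p) (sg' p),
    InTC0.sumElim (f := fun p => Sum.elim (sg p) (sg' p)) hs hs', ?_⟩
  · rintro p (k | k) x <;> rfl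
  · rintro p (k | k)
    · exact h p k
    · exact h' p k

/-- For matrices defined by cases on the position: every entry, as a function of the input, only has
to occur somewhere in a known family. -/
theorem of_exists {κ' : P → Type} {z' : ∀ p, κ' p → (ι p → Bool) → ℤ} (hz' : TC0Int s z')
    (h : ∀ p k, ∃ i, z p k = z' p i) : TC0Int s z := by
  choose e he using h
  exact (hz'.reindex e).congr fun p k x => (congrFun (he p k) x).symm

open Classical in
theorem ite {f : ∀ p, κ p → (ι p → Bool) → Prop} (hf : InTC0 s f) (hy : TC0Int s y)
    (hz : TC0Int s z) : TC0Int s fun p k x => if f p k x then y p k x else z p k x := by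
  obtain ⟨hy, sg, hs, h⟩ := hy
  obtain ⟨hz, sg', hs', h'⟩ := hz
  refine ⟨(hy.ite hf hz).congr fun p k x => by dsimp only; split_ifs <;> rfl, _, hf.ite hs hs',
    fun p k x => ?_⟩
  by_cases hfk : f p k x
  · simpa [hfk] using h p k x
  · simpa [hfk] using h' p k x

theorem mul (hy : TC0Int s y) (hz : TC0Int s z) {W : P → ℕ} (hW : PolyBounded s W)
    (hyW : ∀ p k x, (y p k x).natAbs < 2 ^ W p) (hzW : ∀ p k x, (z p k x).natAbs < 2 ^ W p) :
    TC0Int s fun p k x => y p k x * z p k x := by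
  obtain ⟨hy, sg, hs, h⟩ := hy
  obtain ⟨hz, sg', hs', h'⟩ := hz
  refine ⟨(hy.mul hz hW hyW hzW).congr fun p k x => (Int.natAbs_mul _ _).symm, _,
    (hs.and hs'.not).or (hs'.and hs.not), fun p k x => ⟨?_, fun hn => ?_⟩⟩
  · rintro (⟨h1, h2⟩ | ⟨h1, h2⟩)
    · exact mul_nonpos_of_nonpos_of_nonneg ((h p k x).1 h1) ((h' p k x).2 h2)
    · exact mul_nonpos_of_nonneg_of_nonpos ((h p k x).2 h2) ((h' p k x).1 h1)
  · by_cases h1 : sg p k x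
    · have h2 : sg' p k x := by tauto
      exact mul_nonneg_of_nonpos_of_nonpos ((h p k x).1 h1) ((h' p k x).1 h2)
    · have h2 : ¬sg' p k x := by tauto
      exact mul_nonneg ((h p k x).2 h1) ((h' p k x).2 h2)

theorem add (hy : TC0Int s y) (hz : TC0Int s z) {W : P → ℕ} (hW : PolyBounded s W)
    (hyW : ∀ p k x, (y p k x).natAbs < 2 ^ W p) (hzW : ∀ p k x, (z p k x).natAbs < 2 ^ W p) :
    TC0Int s fun p k x => y p k x + z p k x := by
  classical
  obtain ⟨hy, sg, hs, h⟩ := hy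
  obtain ⟨hz, sg', hs', h'⟩ := hz
  have hd := hy.two_pow_add_sub hz hW hyW hzW
  have hd' := hz.two_pow_add_sub hy hW hzW hyW
  -- Bit `W` of the offset difference compares the magnitudes and the lower bits hold the
  -- difference. The result takes the sign of the larger magnitude.
  have htop (p k x) : (2 ^ W p + (y p k x).natAbs - (z p k x).natAbs).testBit (W p) = true ↔
      (z p k x).natAbs ≤ (y p k x).natAbs := by
    have h1 := hyW p k x
    have h2 := hzW p k x
    by_cases hle : (z p k x).natAbs ≤ (y p k x).natAbs
    · rw [Nat.add_sub_assoc hle, Nat.testBit_two_pow_add_eq, Nat.testBit_lt_two_pow (by omega)]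
      simp [hle]
    · rw [Nat.testBit_lt_two_pow (by omega)]
      simp [hle]
  have hge : InTC0 s fun p k x => (z p k x).natAbs ≤ (y p k x).natAbs :=
    (hd.bit fun p _ => W p).congr htop
  have heq : InTC0 s fun p k x => (sg p k x ↔ sg' p k x) :=
    ((hs.and hs').or (hs.not.and hs'.not)).congr fun p k x => by tauto
  refine ⟨(TC0Nat.ite heq (hy.add hz hW hyW hzW) (TC0Nat.ite hge (hd.mod_two_pow W)
    (hd'.mod_two_pow W))).congr fun p k x => ?_, _, hge.ite hs hs', fun p k x => ?_⟩
  · have h1 := hyW p k x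
    have h2 := hzW p k x
    have h3 := h p k x
    have h4 := h' p k x
    by_cases hle : (z p k x).natAbs ≤ (y p k x).natAbs
    · rw [if_pos hle, Nat.add_sub_assoc hle, Nat.add_mod_left, Nat.mod_eq_of_lt (by omega)]
      by_cases hsg : sg p k x <;> by_cases hsg' : sg' p k x <;>
        simp only [hsg, hsg', not_true_eq_false, not_false_eq_true, true_implies, false_implies,
          and_true, true_and, iff_true, iff_false, if_true, if_false] at h3 h4 ⊢ <;> omega
    · rw [if_neg hle, Nat.add_sub_assoc (by omega), Nat.add_mod_left, Nat.mod_eq_of_lt (by omega)]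
      by_cases hsg : sg p k x <;> by_cases hsg' : sg' p k x <;>
        simp only [hsg, hsg', not_true_eq_false, not_false_eq_true, true_implies, false_implies,
          and_true, true_and, iff_true, iff_false, if_true, if_false] at h3 h4 ⊢ <;> omega
  · have h3 := h p k x
    have h4 := h' p k x
    by_cases hle : (z p k x).natAbs ≤ (y p k x).natAbs <;>
    by_cases hsg : sg p k x <;> by_cases hsg' : sg' p k x <;>
      simp only [hle, hsg, hsg', not_true_eq_false, not_false_eq_true, true_implies, false_implies,
        and_true, true_and] at h3 h4 ⊢ <;> omega

end TC0Int

/-! ### Output bits -/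

/-- Stated for any `u` that agrees with the predicates, so that it applies directly to circuit
outputs. -/
theorem TC0Nat.exists_bits {P : Type} {s : P → ℕ} {ι κ : P → Type}
    {a : ∀ p, κ p → (ι p → Bool) → ℕ} (ha : TC0Nat s a) {W : P → ℕ}
    (haW : ∀ p k x, a p k x < 2 ^ W p) :
    ∃ f : ∀ p, κ p × Fin (W p) → (ι p → Bool) → Prop, InTC0 s f ∧
      ∀ p k x (u : Fin (W p) → Bool), (∀ t, u t = true ↔ f p (k, t) x) → natVal u = a p k x := by
  refine ⟨_, InTC0.reindex ha fun p (k : κ p × Fin (W p)) => (k.1, (k.2 : ℕ)), ?_⟩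
  intro p k x u hu
  rw [← natVal_testBit (haW p k x)]
  congr 1
  funext t
  exact Bool.eq_iff_iff.2 (hu t)

theorem TC0Int.exists_bits {P : Type} {s : P → ℕ} {ι κ : P → Type}
    {z : ∀ p, κ p → (ι p → Bool) → ℤ} (hz : TC0Int s z) {W : P → ℕ}
    (hzW : ∀ p k x, (z p k x).natAbs < 2 ^ W p) :
    ∃ f : ∀ p, κ p × IntWire (W p) → (ι p → Bool) → Prop, InTC0 s f ∧
      ∀ p k x (u : IntWire (W p) → Bool), (∀ t, u t = true ↔ f p (k, t) x) →
        intVal u = z p k x := by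
  obtain ⟨hz, sg, hs, h⟩ := hz
  obtain ⟨f, hf, hfz⟩ := hz.exists_bits hzW
  refine ⟨_, (InTC0.sumElim (f := fun p => Sum.elim (sg p) (f p)) hs hf).reindex
    fun p (k : κ p × IntWire (W p)) => k.2.elim (Sum.inl k.1) fun t => Sum.inr (k.1, t), ?_⟩
  intro p k x u hu
  have h0 := hu none
  have h1 := hfz p k x (fun t => u (some t)) fun t => hu (some t)
  simp only [Option.elim_none, Sum.elim_inl] at h0
  rw [intVal, h1]
  by_cases hsg : sg p k x
  · have := (h p k x).1 hsg
    rw [if_pos (h0.2 hsg)]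
    omega
  · have := (h p k x).2 hsg
    rw [if_neg fun h => hsg (h0.1 h)]
    omega

theorem exists_ratBits {P : Type} {s : P → ℕ} {ι κ : P → Type}
    {num : ∀ p, κ p → (ι p → Bool) → ℤ} {den : ∀ p, κ p → (ι p → Bool) → ℕ}
    (hnum : TC0Int s num) (hden : TC0Nat s den) {W : P → ℕ}
    (hnumW : ∀ p k x, (num p k x).natAbs < 2 ^ W p) (hdenW : ∀ p k x, den p k x < 2 ^ W p) :
    ∃ f : ∀ p, κ p × RatWire (W p) → (ι p → Bool) → Prop, InTC0 s f ∧
      ∀ p k x (u : RatWire (W p) → Bool), (∀ t, u t = true ↔ f p (k, t) x) →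
        den p k x ≠ 0 → EncodesRat u (num p k x / den p k x) := by
  obtain ⟨f, hf, hfz⟩ := hnum.exists_bits hnumW
  obtain ⟨g, hg, hgz⟩ := hden.exists_bits hdenW
  refine ⟨_, (InTC0.sumElim (f := fun p => Sum.elim (f p) (g p)) hf hg).reindex
    fun p (k : κ p × RatWire (W p)) => k.2.elim (fun t => Sum.inl (k.1, t))
      fun t => Sum.inr (k.1, t), ?_⟩
  intro p k x u hu hd
  rw [EncodesRat, hfz p k x (fun t => u (Sum.inl t)) fun t => hu (Sum.inl t),
    hgz p k x (fun t => u (Sum.inr t)) fun t => hu (Sum.inr t)]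
  exact ⟨hd, rfl⟩

theorem natAbs_intVal {w : ℕ} (u : IntWire w → Bool) :
    (intVal u).natAbs = natVal fun t => u (some t) := by
  rw [intVal]
  split_ifs <;> simp

theorem natAbs_intVal_lt {w : ℕ} (u : IntWire w → Bool) : (intVal u).natAbs < 2 ^ w :=
  natAbs_intVal u ▸ natVal_lt _

/-! ### Reductions given by families of systems -/

/-- The size parameter of a system with `m` equations, `n` unknowns and bit length `w`. -/
abbrev sysSize (p : ℕ × ℕ × ℕ) : ℕ := p.1 + p.2.1 + p.2.2

/-- The size parameter of a system together with a solution of bit length `l`. -/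
abbrev solSize (q : (ℕ × ℕ × ℕ) × ℕ) : ℕ := q.1.1 + q.1.2.1 + q.1.2.2 + q.2

theorem isSol_reindex {K : Type} [Field K] {ρ γ : Type} [Fintype γ] {M N : ℕ} (er : ρ ≃ Fin M)
    (ec : γ ≃ Fin N) (A : ρ → γ → ℤ) (b : ρ → ℚ) (x : Fin N → K) :
    IsSol K (fun i j => A (er.symm i) (ec.symm j)) (fun i => b (er.symm i)) x ↔
      ∀ i, ∑ j, (A i j : K) * x (ec j) = (b i : K) := by
  refine Iff.trans (forall_congr' fun i => ?_) (er.symm.surjective.forall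
    (p := fun i => ∑ j, (A i j : K) * x (ec j) = (b i : K))).symm
  rw [← ec.sum_comp]
  simp

/-- Rows and columns may be indexed by structured types, transported by `er` and `ec`. The new
dimensions depend on `p` alone, so the circuit emits them as constants; `hMW` and `hNW` make them
fit into `W` bits. The buffer is then exactly as large as the system. -/
theorem TC0Reducible.of_systems {𝒞 𝒟 : MatrixClass} {ρ γ : ℕ × ℕ × ℕ → Type}
    [∀ p, Fintype (γ p)] {M N W : ℕ × ℕ × ℕ → ℕ} {L : (ℕ × ℕ × ℕ) × ℕ → ℕ}
    (er : ∀ p, ρ p ≃ Fin (M p)) (ec : ∀ p, γ p ≃ Fin (N p))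
    (hM : PolyBounded sysSize M) (hN : PolyBounded sysSize N) (hW : PolyBounded sysSize W)
    (hL : PolyBounded solSize L) (hMW : ∀ p, M p ≤ W p) (hNW : ∀ p, N p ≤ W p)
    {A' : ∀ p : ℕ × ℕ × ℕ, ρ p × γ p → (SysWire p.1 p.2.1 p.2.2 → Bool) → ℤ}
    {num : ∀ p : ℕ × ℕ × ℕ, ρ p → (SysWire p.1 p.2.1 p.2.2 → Bool) → ℤ}
    {den : ∀ p : ℕ × ℕ × ℕ, ρ p → (SysWire p.1 p.2.1 p.2.2 → Bool) → ℕ}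
    (hA' : TC0Int sysSize A') (hnum : TC0Int sysSize num) (hden : TC0Nat sysSize den)
    (hA'W : ∀ p k x, (A' p k x).natAbs < 2 ^ W p)
    (hnumW : ∀ p k x, (num p k x).natAbs < 2 ^ W p) (hdenW : ∀ p k x, den p k x < 2 ^ W p)
    {rnum : ∀ q : (ℕ × ℕ × ℕ) × ℕ, Fin q.1.2.1 → (Fin (N q.1) × RatWire q.2 → Bool) → ℤ}
    {rden : ∀ q : (ℕ × ℕ × ℕ) × ℕ, Fin q.1.2.1 → (Fin (N q.1) × RatWire q.2 → Bool) → ℕ}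
    (hrnum : TC0Int solSize rnum) (hrden : TC0Nat solSize rden)
    (hrnumL : ∀ q k x, (rnum q k x).natAbs < 2 ^ L q) (hrdenL : ∀ q k x, rden q k x < 2 ^ L q)
    (main : ∀ (m n w : ℕ) (A : Matrix (Fin m) (Fin n) ℤ) (b : Fin m → ℚ)
      (u : SysWire m n w → Bool), A ∈ 𝒞 m n → EncodesSystem u A b →
      (fun i j => A' (m, n, w) ((er (m, n, w)).symm i, (ec (m, n, w)).symm j) u) ∈
        𝒟 (M (m, n, w)) (N (m, n, w)) ∧
      ∃ b' : ρ (m, n, w) → ℚ,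
        (∀ i, den (m, n, w) i u ≠ 0 ∧ b' i = num (m, n, w) i u / den (m, n, w) i u) ∧
        ((∃ x : Fin n → ℝ, IsSol ℝ A b x) ↔ ∃ x' : γ (m, n, w) → ℝ,
          ∀ i, ∑ j, (A' (m, n, w) (i, j) u : ℝ) * x' j = b' i) ∧
        ∀ (l : ℕ) (x' : γ (m, n, w) → ℚ) (v : Fin (N (m, n, w)) × RatWire l → Bool),
          (∀ i, ∑ j, (A' (m, n, w) (i, j) u : ℚ) * x' j = b' i) →
          (∀ j, EncodesRat (fun t => v (ec (m, n, w) j, t)) (x' j)) →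
          ∃ x : Fin n → ℚ, (∀ j, rden ((m, n, w), l) j v ≠ 0 ∧
            x j = rnum ((m, n, w), l) j v / rden ((m, n, w), l) j v) ∧ IsSol ℚ A b x) :
    TC0Reducible 𝒞 𝒟 := by
  obtain ⟨fA, hfA, hfA'⟩ := hA'.exists_bits hA'W
  obtain ⟨fb, hfb, hfb'⟩ := exists_ratBits hnum hden hnumW hdenW
  obtain ⟨fr, hfr, hfr'⟩ := exists_ratBits hrnum hrden hrnumL hrdenL
  let fF : ∀ p : ℕ × ℕ × ℕ, PadWire (M p) (N p) (W p) →
      (SysWire p.1 p.2.1 p.2.2 → Bool) → Prop := fun p => Sum.elim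
    (Sum.elim (fun k => fA p (((er p).symm k.1, (ec p).symm k.2.1), k.2.2))
      fun k => fb p ((er p).symm k.1, k.2))
    (Sum.elim (fun t _ => (M p).testBit t = true) fun t _ => (N p).testBit t = true)
  have hfF : InTC0 sysSize fF := by
    refine InTC0.sumElim (InTC0.sumElim ?_ ?_) (InTC0.sumElim ?_ ?_)
    · exact hfA.reindex fun p (k : Fin (M p) × Fin (N p) × IntWire (W p)) =>
        (((er p).symm k.1, (ec p).symm k.2.1), k.2.2)
    · exact hfb.reindex fun p (k : Fin (M p) × RatWire (W p)) => ((er p).symm k.1, k.2)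
    · exact InTC0.const _ fun p (t : Fin (W p)) => (M p).testBit t = true
    · exact InTC0.const _ fun p (t : Fin (W p)) => (N p).testBit t = true
  obtain ⟨F, hF, hFe⟩ := hfF.exists_circuit (by
    simp only [Fintype.card_sum, Fintype.card_prod, Fintype.card_option, Fintype.card_fin]
    have h1 := hW.add (.const _ 1)
    exact ((hM.mul (hN.mul h1)).add (hM.mul (h1.add hW))).add (hW.add hW))
  obtain ⟨R, hR, hRe⟩ := hfr.exists_circuit (by
    simp only [Fintype.card_sum, Fintype.card_prod, Fintype.card_option, Fintype.card_fin]
    exact (PolyBounded.of_le fun q => by simp only [solSize]; omega).mul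
      ((hL.add (.const _ 1)).add hL))
  refine ⟨M, N, W, L, F, R, hM, hN, hW, hL, hF, hR, fun m n w A b u hA hu => ?_⟩
  obtain ⟨hD, b', hb', hsol, hback⟩ := main m n w A b u hA hu
  refine ⟨_, _, _, fun i => b' ((er (m, n, w)).symm i), hD, ⟨?_, ?_, le_rfl, le_rfl, ?_, ?_⟩,
    hsol.trans ?_, fun l x' v hx' hv => ?_⟩
  · refine Eq.trans ?_ (natVal_testBit ((hMW _).trans_lt Nat.lt_two_pow_self))
    exact congrArg _ (funext fun t => Bool.eq_iff_iff.2 (hFe _ _ _))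
  · refine Eq.trans ?_ (natVal_testBit ((hNW _).trans_lt Nat.lt_two_pow_self))
    exact congrArg _ (funext fun t => Bool.eq_iff_iff.2 (hFe _ _ _))
  · exact fun i j => hfA' _ _ _ _ fun t => hFe _ _ _
  · intro i
    have h := hb' ((er (m, n, w)).symm i)
    simp only [h.2]
    exact hfb' _ _ _ _ (fun t => hFe _ _ _) h.1
  · constructor
    · rintro ⟨x', hx'⟩
      refine ⟨fun j => x' ((ec (m, n, w)).symm j), (isSol_reindex _ (ec (m, n, w))
        (fun i j => A' (m, n, w) (i, j) u) b' _).2 ?_⟩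
      simpa using hx'
    · rintro ⟨x', hx'⟩
      exact ⟨_, (isSol_reindex (er (m, n, w)) (ec (m, n, w))
        (fun i j => A' (m, n, w) (i, j) u) b' _).1 hx'⟩
  · obtain ⟨hn, hv⟩ := hv
    obtain ⟨x, hx, hAx⟩ := hback l _ v
      ((isSol_reindex (er (m, n, w)) (ec (m, n, w)) (fun i j => A' (m, n, w) (i, j) u) b' _).1
        hx')
        fun j => hv _
    refine ⟨x, ⟨le_rfl, fun j => ?_⟩, hAx⟩
    rw [(hx j).2]
    exact hfr' ((m, n, w), l) j v _ (fun t => hRe ((m, n, w), l) v (j, t)) (hx j).1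

/-! ### Decoding the input -/

/-- The entries of the encoded matrix. -/
def inMat {m n w : ℕ} (k : Fin m × Fin n) (u : SysWire m n w → Bool) : ℤ :=
  intVal fun t => u (Sum.inl (k.1, k.2, t))

/-- The numerators of the encoded right-hand side. -/
def inNum {m n w : ℕ} (i : Fin m) (u : SysWire m n w → Bool) : ℤ :=
  intVal fun t => u (Sum.inr (i, Sum.inl t))

/-- The denominators of the encoded right-hand side. -/
def inDen {m n w : ℕ} (i : Fin m) (u : SysWire m n w → Bool) : ℕ :=
  natVal fun t => u (Sum.inr (i, Sum.inr t))

theorem tc0Int_inMat : TC0Int sysSize fun p : ℕ × ℕ × ℕ =>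
    inMat (m := p.1) (n := p.2.1) (w := p.2.2) :=
  TC0Int.ofBits sysSize fun p (k : Fin p.1 × Fin p.2.1) t => Sum.inl (k.1, k.2, t)

theorem tc0Int_inNum : TC0Int sysSize fun p : ℕ × ℕ × ℕ =>
    inNum (m := p.1) (n := p.2.1) (w := p.2.2) :=
  TC0Int.ofBits sysSize fun _ i t => Sum.inr (i, Sum.inl t)

theorem tc0Nat_inDen : TC0Nat sysSize fun p : ℕ × ℕ × ℕ =>
    inDen (m := p.1) (n := p.2.1) (w := p.2.2) :=
  TC0Nat.ofBits sysSize fun _ i t => Sum.inr (i, Sum.inr t)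

theorem natAbs_inMat_lt {m n w W : ℕ} (h : w ≤ W) (k : Fin m × Fin n)
    (u : SysWire m n w → Bool) : (inMat k u).natAbs < 2 ^ W :=
  (natAbs_intVal_lt _).trans_le (Nat.pow_le_pow_right two_pos h)

theorem natAbs_inNum_lt {m n w W : ℕ} (h : w ≤ W) (i : Fin m) (u : SysWire m n w → Bool) :
    (inNum i u).natAbs < 2 ^ W :=
  (natAbs_intVal_lt _).trans_le (Nat.pow_le_pow_right two_pos h)

theorem inDen_lt {m n w W : ℕ} (h : w ≤ W) (i : Fin m) (u : SysWire m n w → Bool) :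
    inDen i u < 2 ^ W :=
  (natVal_lt _).trans_le (Nat.pow_le_pow_right two_pos h)

/-- The numerators of an encoded vector. -/
def vecNum {N l : ℕ} (j : Fin N) (v : Fin N × RatWire l → Bool) : ℤ :=
  intVal fun t => v (j, Sum.inl t)

/-- The denominators of an encoded vector. -/
def vecDen {N l : ℕ} (j : Fin N) (v : Fin N × RatWire l → Bool) : ℕ :=
  natVal fun t => v (j, Sum.inr t)

theorem tc0Int_vecNum {N : ℕ × ℕ × ℕ → ℕ} : TC0Int solSize fun q : (ℕ × ℕ × ℕ) × ℕ =>
    vecNum (N := N q.1) (l := q.2) :=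
  TC0Int.ofBits solSize fun _ j t => (j, Sum.inl t)

theorem tc0Nat_vecDen {N : ℕ × ℕ × ℕ → ℕ} : TC0Nat solSize fun q : (ℕ × ℕ × ℕ) × ℕ =>
    vecDen (N := N q.1) (l := q.2) :=
  TC0Nat.ofBits solSize fun _ j t => (j, Sum.inr t)

/-! ### From `classG` to `classGz` -/

section reindex

variable {ρ γ : Type} {M N : ℕ} (er : ρ ≃ Fin M) (ec : γ ≃ Fin N) {A : ρ → γ → ℤ}

theorem mem_classG_reindex (hrow : ∀ i, ∃ j, A i j ≠ 0) (hcol : ∀ j, ∃ i, A i j ≠ 0) :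
    (fun i j => A (er.symm i) (ec.symm j)) ∈ classG M N := by
  refine ⟨fun i => ?_, fun j => ?_⟩
  · obtain ⟨j, hj⟩ := hrow (er.symm i)
    exact ⟨ec j, by simpa only [Equiv.symm_apply_apply] using hj⟩
  · obtain ⟨i, hi⟩ := hcol (ec.symm j)
    exact ⟨er i, by simpa only [Equiv.symm_apply_apply] using hi⟩

variable [Fintype γ]

theorem mem_classGz_reindex (hrow : ∀ i, ∃ j, A i j ≠ 0) (hcol : ∀ j, ∃ i, A i j ≠ 0)
    (hsum : ∀ i, ∑ j, A i j = 0) :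
    (fun i j => A (er.symm i) (ec.symm j)) ∈ classGz M N := by
  refine ⟨mem_classG_reindex er ec hrow hcol, fun i => ?_⟩
  rw [← hsum (er.symm i)]
  exact ec.symm.sum_comp fun j => A (er.symm i) j

theorem mem_classGz2_reindex (hrow : ∀ i, ∃ j, A i j ≠ 0) (hcol : ∀ j, ∃ i, A i j ≠ 0)
    (hsum : ∀ i, ∑ j, A i j = 0) (hpos : ∀ i, ∃ k : ℕ, ∑ j, max (A i j) 0 = 2 ^ k) :
    (fun i j => A (er.symm i) (ec.symm j)) ∈ classGz2 M N := by
  refine ⟨mem_classGz_reindex er ec hrow hcol hsum, fun i => ?_⟩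
  obtain ⟨k, hk⟩ := hpos (er.symm i)
  refine ⟨k, ?_⟩
  rw [← hk, Finset.sum_filter, ← ec.symm.sum_comp]
  refine Finset.sum_congr rfl fun j _ => ?_
  split_ifs with h
  · exact (max_eq_left h.le).symm
  · exact (max_eq_right (not_lt.1 h)).symm

end reindex

theorem isSol_sub_of_isSol {K : Type} [Field K] {m n : ℕ} {A : Matrix (Fin m) (Fin n) ℤ}
    {b : Fin m → ℚ} {y z : Fin n → K}
    (h : ∀ i, ∑ j, (A i j : K) * y j + ∑ j, ((-A i j : ℤ) : K) * z j = (b i : K)) :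
    IsSol K A b fun j => y j - z j := by
  intro i
  rw [← h i, ← Finset.sum_add_distrib]
  refine Finset.sum_congr rfl fun j _ => ?_
  push_cast
  ring

theorem tc0Reducible_classG_classGz : TC0Reducible classG classGz := by
  have hmul {l : ℕ} {a b : ℕ} (ha : a < 2 ^ l) (hb : b < 2 ^ l) : a * b < 2 ^ (2 * l) := by
    rw [two_mul, pow_add]
    exact Nat.mul_lt_mul'' ha hb
  have hprod {N l : ℕ} (i j : Fin N) (v : Fin N × RatWire l → Bool) :
      (vecNum i v * (vecDen j v : ℤ)).natAbs < 2 ^ (2 * l) := by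
    rw [Int.natAbs_mul]
    exact hmul (natAbs_intVal_lt _) (natVal_lt _)
  have hl : PolyBounded solSize fun q => q.2 := .of_le fun q => by simp only [solSize]; omega
  refine TC0Reducible.of_systems (ρ := fun p => Fin p.1) (γ := fun p => Fin p.2.1 ⊕ Fin p.2.1)
    (M := fun p => p.1) (N := fun p => p.2.1 + p.2.1)
    -- The decoder subtracts fractions by cross-multiplication: products of `l`-bit numbers need `2
    -- l` bits, and their difference one more.
    (W := fun p => p.1 + (p.2.1 + p.2.1) + p.2.2) (L := fun q => 2 * q.2 + 1)
    (fun p => Equiv.refl _) (fun p => finSumFinEquiv) ?_ ?_ ?_ ?_ (fun p => by omega)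
    (fun p => by omega)
    (A' := fun p k u => Sum.elim (fun j => inMat (k.1, j) u) (fun j => -inMat (k.1, j) u) k.2)
    (num := fun p => inNum) (den := fun p => inDen) ?_ tc0Int_inNum tc0Nat_inDen ?_ ?_ ?_
    (rnum := fun q j v => vecNum (finSumFinEquiv (Sum.inl j)) v *
        vecDen (finSumFinEquiv (Sum.inr j)) v + -(vecNum (finSumFinEquiv (Sum.inr j)) v *
        vecDen (finSumFinEquiv (Sum.inl j)) v))
    (rden := fun q j v => vecDen (finSumFinEquiv (Sum.inl j)) v *
        vecDen (finSumFinEquiv (Sum.inr j)) v) ?_ ?_ ?_ ?_ ?_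
  · exact .of_le fun p => by simp only [sysSize]; omega
  · have : PolyBounded sysSize fun p => p.2.1 := .of_le fun p => by simp only [sysSize]; omega
    exact this.add this
  · have h : PolyBounded sysSize fun p => p.2.1 := .of_le fun p => by simp only [sysSize]; omega
    exact (PolyBounded.add (.of_le fun p => by simp only [sysSize]; omega) (h.add h)).add
      (.of_le fun p => by simp only [sysSize]; omega)
  · exact ((PolyBounded.const _ 2).mul hl).add (.const _ 1)
  · refine (tc0Int_inMat.sumElim tc0Int_inMat.neg).of_exists ?_
    rintro p ⟨i, j | j⟩
    · exact ⟨Sum.inl (i, j), rfl⟩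
    · exact ⟨Sum.inr (i, j), rfl⟩
  · rintro p ⟨i, j | j⟩ x
    · exact natAbs_inMat_lt (Nat.le_add_left _ _) _ _
    · exact (Int.natAbs_neg _).trans_lt (natAbs_inMat_lt (Nat.le_add_left _ _) _ _)
  · exact fun p k x => natAbs_inNum_lt (Nat.le_add_left _ _) _ _
  · exact fun p k x => inDen_lt (Nat.le_add_left _ _) _ _
  · have h1 (e : ∀ q : (ℕ × ℕ × ℕ) × ℕ, Fin q.1.2.1 → Fin (q.1.2.1 + q.1.2.1))
        (e' : ∀ q : (ℕ × ℕ × ℕ) × ℕ, Fin q.1.2.1 → Fin (q.1.2.1 + q.1.2.1)) :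
        TC0Int solSize fun q j (v : Fin (q.1.2.1 + q.1.2.1) × RatWire q.2 → Bool) =>
          vecNum (e q j) v * (vecDen (e' q j) v : ℤ) :=
      ((tc0Int_vecNum (N := fun p => p.2.1 + p.2.1)).reindex e).mul
        (TC0Int.natCast ((tc0Nat_vecDen (N := fun p => p.2.1 + p.2.1)).reindex e'))
        hl (fun q k x => natAbs_intVal_lt _) fun q k x => natVal_lt _
    exact (h1 _ _).add (h1 _ _).neg ((PolyBounded.const _ 2).mul hl)
      (fun q k x => hprod _ _ _) fun q k x => (Int.natAbs_neg _).trans_lt (hprod _ _ _)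
  · exact ((tc0Nat_vecDen (N := fun p => p.2.1 + p.2.1)).reindex _).mul
      ((tc0Nat_vecDen (N := fun p => p.2.1 + p.2.1)).reindex _) hl (fun q k x => natVal_lt _)
      fun q k x => natVal_lt _
  · intro q k x
    refine (Int.natAbs_add_le _ _).trans_lt ?_
    rw [Int.natAbs_neg, pow_succ, mul_two]
    exact add_lt_add (hprod _ _ _) (hprod _ _ _)
  · exact fun q k x => (hmul (natVal_lt _) (natVal_lt _)).trans
      (Nat.pow_lt_pow_right one_lt_two (Nat.lt_succ_self _))
  · rintro m n w A b u ⟨hrow, hcol⟩ ⟨hA, hb⟩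
    have hA (i j) : inMat (i, j) u = A i j := hA i j
    simp only [hA]
    refine ⟨mem_classGz_reindex (Equiv.refl (Fin m)) finSumFinEquiv
      (A := fun i => Sum.elim (fun j => A i j) fun j => -A i j) (fun i => ?_) ?_ fun i => ?_,
      b, hb, ⟨?_, ?_⟩, ?_⟩
    · obtain ⟨j, hj⟩ := hrow i
      exact ⟨Sum.inl j, hj⟩
    · rintro (j | j)
      · exact hcol j
      · obtain ⟨i, hi⟩ := hcol j
        exact ⟨i, neg_ne_zero.2 hi⟩
    · simp
    · rintro ⟨x, hx⟩
      -- Take `y = x` and `z = 0`.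
      exact ⟨Sum.elim x 0, fun i => by simpa using hx i⟩
    · rintro ⟨x', hx'⟩
      exact ⟨_, isSol_sub_of_isSol fun i => by simpa using hx' i⟩
    · intro l x' v hx' hv
      refine ⟨_, fun j => ⟨?_, ?_⟩, isSol_sub_of_isSol fun i => by simpa using hx' i⟩
      · exact mul_ne_zero (hv (Sum.inl j)).1 (hv (Sum.inr j)).1
      · obtain ⟨h1, h2⟩ := hv (Sum.inl j)
        obtain ⟨h3, h4⟩ := hv (Sum.inr j)
        rw [h2, h4, div_sub_div _ _ (Nat.cast_ne_zero.2 h1) (Nat.cast_ne_zero.2 h3)]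
        dsimp only [vecNum, vecDen]
        push_cast
        congr 1
        ring

/-! ### From `classGz` to `classGz2` -/

theorem TC0Int.max_zero {P : Type} {s : P → ℕ} {ι κ : P → Type}
    {z : ∀ p, κ p → (ι p → Bool) → ℤ} (hz : TC0Int s z) :
    TC0Nat s fun p k x => (z p k x).toNat := by
  classical
  obtain ⟨hz, sg, hs, h⟩ := hz
  refine (TC0Nat.ite hs (.const s fun _ _ => 0) hz).congr fun p k x => ?_
  have := h p k x
  by_cases hk : sg p k x
  · have := this.1 hk
    rw [if_pos hk]
    omega
  · have := this.2 hk
    rw [if_neg hk]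
    omega

/-- The coefficients that complete the positive entries of a row to the sum `2 ^ (n + w)`. -/
def padCoeff {n : ℕ} (w : ℕ) (a : Fin n → ℤ) : Fin (n + 1) → ℤ :=
  Fin.cons (2 ^ (n + w) - n * (2 ^ w - 1)) fun j => 2 ^ w - 1 - (a j).toNat

/-- The last `n` coefficients raise each positive part to `2 ^ w - 1`; the zeroth supplies the rest
up to `2 ^ (n + w)` and does not depend on the row. Hence no circuit has to sum a row. -/
theorem sum_padCoeff {n : ℕ} (w : ℕ) (a : Fin n → ℤ) :
    ∑ l, padCoeff w a l = 2 ^ (n + w) - ∑ j, max (a j) 0 := by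
  rw [Fin.sum_univ_succ]
  simp only [padCoeff, Fin.cons_zero, Fin.cons_succ, Finset.sum_sub_distrib, Int.ofNat_toNat]
  simp
  ring

theorem padCoeff_nonneg {n w : ℕ} {a : Fin n → ℤ} (ha : ∀ j, (a j).natAbs < 2 ^ w)
    (l : Fin (n + 1)) : 0 ≤ padCoeff w a l := by
  induction l using Fin.cases with
  | zero =>
    -- This is why the target is `2 ^ (n + w)`: it exceeds `n * (2 ^ w - 1)`.
    have h : (n : ℤ) ≤ 2 ^ n := by exact_mod_cast Nat.lt_two_pow_self.le
    have h' : (1 : ℤ) ≤ 2 ^ w := one_le_pow₀ one_le_two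
    simp only [padCoeff, Fin.cons_zero, pow_add]
    nlinarith
  | succ j =>
    have h : (a j).toNat < 2 ^ w := by
      have := ha j
      omega
    zify at h
    simp only [padCoeff, Fin.cons_succ]
    omega

theorem padCoeff_le {n w : ℕ} (a : Fin n → ℤ) (l : Fin (n + 1)) :
    padCoeff w a l ≤ 2 ^ (n + w) := by
  have h' : (1 : ℤ) ≤ 2 ^ w := one_le_pow₀ one_le_two
  induction l using Fin.cases with
  | zero =>
    simp only [padCoeff, Fin.cons_zero]
    nlinarith [Int.natCast_nonneg n]
  | succ j =>
    have h : (2 : ℤ) ^ w ≤ 2 ^ (n + w) := pow_le_pow_right₀ one_le_two (Nat.le_add_left _ _)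
    simp only [padCoeff, Fin.cons_succ]
    omega

/-- The matrix with rows `a i * x + ∑ l, c i l * (y l - z l)` and `y l - z l`. -/
def padMat {m n k : ℕ} (a : Fin m → Fin n → ℤ) (c : Fin m → Fin k → ℤ) :
    Fin m ⊕ Fin k → Fin n ⊕ (Fin k ⊕ Fin k) → ℤ
  | Sum.inl i => Sum.elim (a i) (Sum.elim (c i) fun l => -c i l)
  | Sum.inr l => Sum.elim 0 (Sum.elim (Pi.single l 1) (-Pi.single l 1))

section padMat

variable {m n k : ℕ} {a : Fin m → Fin n → ℤ} {c : Fin m → Fin k → ℤ} {K : Type} [Field K]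

/-- The rows for `l` force the paired unknowns to agree, which removes the padding from all other
rows. -/
theorem padMat_mulVec_iff {b : Fin m → ℚ} {x : Fin n ⊕ (Fin k ⊕ Fin k) → K} :
    (∀ i, ∑ j, (padMat a c i j : K) * x j = ((Sum.elim b 0 i : ℚ) : K)) ↔
      (∀ i, ∑ j, (a i j : K) * x (Sum.inl j) = (b i : K)) ∧
        ∀ l, x (Sum.inr (Sum.inl l)) = x (Sum.inr (Sum.inr l)) := by
  have h1 (l : Fin k) : ∑ j, (padMat a c (Sum.inr l) j : K) * x j =
      x (Sum.inr (Sum.inl l)) - x (Sum.inr (Sum.inr l)) := by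
    simp [padMat, Pi.single_apply, ← sub_eq_add_neg]
  have h2 (i : Fin m) : ∑ j, (padMat a c (Sum.inl i) j : K) * x j =
      ∑ j, (a i j : K) * x (Sum.inl j) +
        ∑ l, (c i l : K) * (x (Sum.inr (Sum.inl l)) - x (Sum.inr (Sum.inr l))) := by
    simp [padMat, mul_sub, ← sub_eq_add_neg]
  rw [Sum.forall]
  simp only [h1, h2, Sum.elim_inl, Sum.elim_inr, Pi.zero_apply, Rat.cast_zero, sub_eq_zero]
  refine and_congr_left fun h => ?_
  simp [h]

theorem sum_padMat (h : ∀ i, ∑ j, a i j = 0) (i) : ∑ j, padMat a c i j = 0 := by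
  rcases i with i | l <;> simp [padMat, h]

/-- Of each pair `c, -c` only `c` counts. The rows `y l - z l` have positive part `1 = 2 ^ 0`. -/
theorem sum_max_padMat (hc : ∀ i l, 0 ≤ c i l) {K : ℕ}
    (h : ∀ i, ∑ l, c i l = 2 ^ K - ∑ j, max (a i j) 0) (i) :
    ∃ K : ℕ, ∑ j, max (padMat a c i j) 0 = 2 ^ K := by
  rcases i with i | l
  · refine ⟨K, ?_⟩
    simp [padMat, hc, h]
  · refine ⟨0, ?_⟩
    rw [Fintype.sum_sum_type, Fintype.sum_sum_type]
    have h1 (j : Fin k) : max ((Pi.single l (1 : ℤ) : Fin k → ℤ) j) 0 =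
        if j = l then 1 else 0 := by
      by_cases hj : j = l <;> simp [hj]
    have h2 (j : Fin k) : max (-(Pi.single l (1 : ℤ) : Fin k → ℤ) j) 0 = 0 := by
      by_cases hj : j = l <;> simp [hj]
    simp [padMat, h1, h2]

end padMat

theorem tc0Int_padCoeff : TC0Int sysSize fun (p : ℕ × ℕ × ℕ) (k : Fin p.1 × Fin (p.2.1 + 1))
    (u : SysWire p.1 p.2.1 p.2.2 → Bool) => padCoeff p.2.2 (fun j => inMat (k.1, j) u) k.2 := by
  have h := TC0Int.natCast ((tc0Int_inMat.max_zero).compl (fun p => p.2.2) fun p k x => by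
    have := natAbs_inMat_lt le_rfl k x
    omega)
  refine ((TC0Int.const sysSize fun _ (z : ℤ) => z).sumElim h).of_exists ?_
  rintro p ⟨i, l⟩
  induction l using Fin.cases with
  | zero => exact ⟨Sum.inl _, rfl⟩
  | succ j =>
    refine ⟨Sum.inr (i, j), ?_⟩
    funext u
    have := natAbs_inMat_lt le_rfl (i, j) u
    have h2 : ((2 ^ p.2.2 : ℕ) : ℤ) = 2 ^ p.2.2 := by push_cast; rfl
    simp only [padCoeff, Fin.cons_succ, Sum.elim_inr]
    omega

theorem tc0Reducible_classGz_classGz2 : TC0Reducible classGz classGz2 := by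
  have hm : PolyBounded sysSize fun p => p.1 := .of_le fun p => by simp only [sysSize]; omega
  have hn : PolyBounded sysSize fun p => p.2.1 := .of_le fun p => by simp only [sysSize]; omega
  have hw : PolyBounded sysSize fun p => p.2.2 := .of_le fun p => by simp only [sysSize]; omega
  have hn1 := hn.add (.const _ 1)
  have hl : PolyBounded solSize fun q => q.2 := .of_le fun q => by simp only [solSize]; omega
  have hM := hm.add hn1
  have hN := hn.add (hn1.add hn1)
  have hcoeff (p : ℕ × ℕ × ℕ) (i : Fin p.1) (u : SysWire p.1 p.2.1 p.2.2 → Bool) (l) :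
      (padCoeff p.2.2 (fun j => inMat (i, j) u) l).natAbs < 2 ^ (p.2.1 + p.2.2 + 1) := by
    have h1 := padCoeff_nonneg (fun j => natAbs_inMat_lt le_rfl (i, j) u) l
    have h2 := padCoeff_le (w := p.2.2) (fun j => inMat (i, j) u) l
    have h3 : (0 : ℤ) < 2 ^ (p.2.1 + p.2.2) := by positivity
    zify
    rw [abs_of_nonneg h1, pow_succ]
    omega
  refine TC0Reducible.of_systems (ρ := fun p => Fin p.1 ⊕ Fin (p.2.1 + 1))
    (γ := fun p => Fin p.2.1 ⊕ (Fin (p.2.1 + 1) ⊕ Fin (p.2.1 + 1)))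
    (M := fun p => p.1 + (p.2.1 + 1)) (N := fun p => p.2.1 + ((p.2.1 + 1) + (p.2.1 + 1)))
    -- The last summand is for the padding coefficients: they may equal `2 ^ (n + w)`, which takes
    -- `n + w + 1` bits.
    (W := fun p => p.1 + (p.2.1 + 1) + (p.2.1 + ((p.2.1 + 1) + (p.2.1 + 1))) +
      (p.2.1 + p.2.2 + 1)) (L := fun q => q.2)
    (fun p => finSumFinEquiv) (fun p => (Equiv.sumCongr (Equiv.refl _) finSumFinEquiv).trans
      finSumFinEquiv) hM hN ((hM.add hN).add ((hn.add hw).add (.const _ 1))) hl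
    (fun p => by omega) (fun p => by omega)
    (A' := fun p k u => padMat (fun i j => inMat (i, j) u)
      (fun i l => padCoeff p.2.2 (fun j => inMat (i, j) u) l) k.1 k.2)
    (num := fun p => Sum.elim inNum fun _ _ => 0) (den := fun p => Sum.elim inDen fun _ _ => 1)
    ?_ (tc0Int_inNum.sumElim (.const _ _)) (tc0Nat_inDen.sumElim (.const _ _)) ?_ ?_ ?_
    (rnum := fun q j => vecNum (finSumFinEquiv (Sum.inl j)))
    (rden := fun q j => vecDen (finSumFinEquiv (Sum.inl j)))
    ((tc0Int_vecNum (N := fun p => p.2.1 + ((p.2.1 + 1) + (p.2.1 + 1)))).reindex _)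
    ((tc0Nat_vecDen (N := fun p => p.2.1 + ((p.2.1 + 1) + (p.2.1 + 1)))).reindex _)
    (fun q k x => natAbs_intVal_lt _)
    (fun q k x => natVal_lt _) ?_
  · refine ((tc0Int_inMat.sumElim tc0Int_padCoeff).sumElim (tc0Int_padCoeff.neg.sumElim
      (TC0Int.const sysSize fun _ (z : ℤ) => z))).of_exists ?_
    rintro p ⟨i | l, j | l' | l'⟩
    · exact ⟨Sum.inl (Sum.inl (i, j)), rfl⟩
    · exact ⟨Sum.inl (Sum.inr (i, l')), rfl⟩
    · exact ⟨Sum.inr (Sum.inl (i, l')), rfl⟩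
    all_goals exact ⟨Sum.inr (Sum.inr _), rfl⟩
  · rintro p ⟨i | l, j | l' | l'⟩ x
    · exact natAbs_inMat_lt (by omega) _ _
    · exact (hcoeff p i x l').trans_le (Nat.pow_le_pow_right two_pos (by omega))
    · exact (Int.natAbs_neg _).trans_lt
        ((hcoeff p i x l').trans_le (Nat.pow_le_pow_right two_pos (by omega)))
    · exact Nat.two_pow_pos _
    · refine lt_of_le_of_lt ?_ (Nat.one_lt_two_pow (Nat.succ_ne_zero _))
      by_cases h : l' = l <;> simp [padMat, h]
    · refine lt_of_le_of_lt ?_ (Nat.one_lt_two_pow (Nat.succ_ne_zero _))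
      by_cases h : l' = l <;> simp [padMat, h]
  · rintro p (i | l) x
    · exact natAbs_inNum_lt (by omega) _ _
    · exact Nat.two_pow_pos _
  · rintro p (i | l) x
    · exact inDen_lt (by omega) _ _
    · exact Nat.one_lt_two_pow (Nat.succ_ne_zero _)
  · rintro m n w A b u ⟨⟨hrow, hcol⟩, hsum⟩ ⟨hA, hb⟩
    have hA (i j) : inMat (i, j) u = A i j := hA i j
    have hAw (i j) : (A i j).natAbs < 2 ^ w := hA i j ▸ natAbs_inMat_lt le_rfl (i, j) u
    simp only [hA]
    refine ⟨mem_classGz2_reindex _ _ ?_ ?_ (sum_padMat hsum)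
      (sum_max_padMat (fun i => padCoeff_nonneg (hAw i)) fun i => sum_padCoeff w (A i)),
      Sum.elim b 0, ?_, ⟨?_, ?_⟩, ?_⟩
    · rintro (i | l)
      · obtain ⟨j, hj⟩ := hrow i
        exact ⟨Sum.inl j, hj⟩
      · exact ⟨Sum.inr (Sum.inl l), by simp [padMat]⟩
    · rintro (j | l | l)
      · obtain ⟨i, hi⟩ := hcol j
        exact ⟨Sum.inl i, hi⟩
      · exact ⟨Sum.inr l, by simp [padMat]⟩
      · exact ⟨Sum.inr l, by simp [padMat]⟩
    · rintro (i | l)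
      · exact hb i
      · simp
    · rintro ⟨x, hx⟩
      exact ⟨Sum.elim x 0, padMat_mulVec_iff.2 ⟨hx, fun _ => rfl⟩⟩
    · rintro ⟨x', hx'⟩
      exact ⟨_, (padMat_mulVec_iff.1 hx').1⟩
    · intro l x' v hx' hv
      exact ⟨_, fun j => hv (Sum.inl j), (padMat_mulVec_iff.1 hx').1⟩

/-! ### Addition gadgets in 2-commodity systems -/

/-- The three kinds of equations of a 2-commodity system: `x_u - x_v`, `y_u - y_v`, and
`x_u - y_u - (x_v - y_v)`. -/
inductive Commodity : Type
  | x
  | y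
  | diff

/-- The coefficient of `x_u` in an equation between `u` and `v`. -/
def Commodity.xCoeff : Commodity → ℤ
  | x => 1
  | y => 0
  | diff => 1

/-- The coefficient of `y_u` in an equation between `u` and `v`. -/
def Commodity.yCoeff : Commodity → ℤ
  | x => 0
  | y => 1
  | diff => -1

section edge

variable {V : Type} [DecidableEq V]

/-- The coefficient vector of an equation, given by its kind and a pair of vertices. -/
def edgeVec (e : Commodity × V × V) : V ⊕ V → ℤ :=
  Sum.elim
    (fun a => e.1.xCoeff * ((Pi.single e.2.1 1 : V → ℤ) a - (Pi.single e.2.2 1 : V → ℤ) a))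
    fun a => e.1.yCoeff * ((Pi.single e.2.1 1 : V → ℤ) a - (Pi.single e.2.2 1 : V → ℤ) a)

theorem natAbs_edgeVec_le (e : Commodity × V × V) (a : V ⊕ V) : (edgeVec e a).natAbs ≤ 1 := by
  obtain ⟨k, u, v⟩ := e
  rcases a with a | a <;> by_cases hu : a = u <;> by_cases hv : a = v <;> cases k <;>
    simp [edgeVec, Commodity.xCoeff, Commodity.yCoeff, Pi.single_apply, hu, hv] <;>
    split_ifs <;> simp

theorem sum_edgeVec [Fintype V] {K : Type} [Field K] (e : Commodity × V × V) (p : V ⊕ V → K) :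
    ∑ a, (edgeVec e a : K) * p a =
      e.1.xCoeff * (p (Sum.inl e.2.1) - p (Sum.inl e.2.2)) +
        e.1.yCoeff * (p (Sum.inr e.2.1) - p (Sum.inr e.2.2)) := by
  have h (c : ℤ) (q : V → K) : ∑ a, ((c * ((Pi.single e.2.1 1 : V → ℤ) a -
      (Pi.single e.2.2 1 : V → ℤ) a) : ℤ) : K) * q a = c * (q e.2.1 - q e.2.2) := by
    simp [Pi.single_apply, mul_assoc, ← Finset.mul_sum, sub_mul]
  rw [Fintype.sum_sum_type]
  exact congrArg₂ _ (h _ _) (h _ _)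

theorem isTwoCommodityRow_edgeVec {k : ℕ} (ev : V ≃ Fin k) {e : Commodity × V × V}
    (he : e.2.1 ≠ e.2.2) : IsTwoCommodityRow fun t =>
      edgeVec e (((Equiv.sumCongr ev ev).trans finSumFinEquiv).symm t) := by
  obtain ⟨c, u, v⟩ := e
  let E : V ⊕ V ≃ Fin (k + k) := (Equiv.sumCongr ev ev).trans finSumFinEquiv
  refine ⟨1, ev u, ev v, one_ne_zero, ev.injective.ne he, ?_⟩
  have hx (u a : V) : xVar (ev u) (E (Sum.inl a)) = (Pi.single u 1 : V → ℤ) a := by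
    simp [E, xVar, Pi.single_apply]
  have hx' (u a : V) : xVar (ev u) (E (Sum.inr a)) = 0 := by
    simp [E, xVar, Pi.single_apply, Fin.ext_iff]
    omega
  have hy (u a : V) : yVar (ev u) (E (Sum.inr a)) = (Pi.single u 1 : V → ℤ) a := by
    simp [E, yVar, Pi.single_apply]
  have hy' (u a : V) : yVar (ev u) (E (Sum.inl a)) = 0 := by
    simp [E, yVar, Pi.single_apply, Fin.ext_iff]
    omega
  have hext (f : V ⊕ V → ℤ) (g : Fin (k + k) → ℤ) (h1 : ∀ a, f (Sum.inl a) = g (E (Sum.inl a)))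
      (h2 : ∀ a, f (Sum.inr a) = g (E (Sum.inr a))) : (fun t => f (E.symm t)) = g := by
    funext t
    obtain ⟨a | a, rfl⟩ := E.surjective t
    · rw [E.symm_apply_apply, h1]
    · rw [E.symm_apply_apply, h2]
  rw [one_smul, one_smul, one_smul]
  cases c
  · refine Or.inl (hext _ _ (fun a => ?_) fun a => ?_) <;>
      simp [edgeVec, Commodity.xCoeff, Commodity.yCoeff, hx, hx']
  · refine Or.inr (Or.inl (hext _ _ (fun a => ?_) fun a => ?_)) <;>
      simp [edgeVec, Commodity.xCoeff, Commodity.yCoeff, hy, hy']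
  · refine Or.inr (Or.inr (hext _ _ (fun a => ?_) fun a => ?_))
    · simp [edgeVec, Commodity.xCoeff, Commodity.yCoeff, hx, hy']
    · simp [edgeVec, Commodity.xCoeff, Commodity.yCoeff, hx', hy]
      ring

end edge

/-- The nodes of a straight-line program with additions only: the constant zero, the inputs,
and the addition gates. -/
abbrev Node (I G : Type) : Type := Option I ⊕ G

/-- The vertices of the 2-commodity system of a straight-line program: one for every node, and
two auxiliary ones for every gate. -/
abbrev Vertex (I G : Type) : Type := Option I ⊕ (G × Fin 3)

section program

variable {I G F : Type}

/-- The vertex of a node. -/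
def Node.vertex : Node I G → Vertex I G :=
  Sum.map id fun g => (g, 0)

/-- The equations of the 2-commodity system of a straight-line program: gate `g` adds the nodes
`s₁ g` and `s₂ g`, and output `i` is the difference of the nodes `f₁ i` and `f₂ i`. -/
def programEdge (s₁ s₂ : G → Node I G) (f₁ f₂ : F → Node I G) :
    I ⊕ ((G × Fin 6) ⊕ F) → Commodity × Vertex I G × Vertex I G
  | Sum.inl j => (.diff, Sum.inl (some j), Sum.inl none)
  | Sum.inr (Sum.inl (g, r)) =>
    ![(.diff, Sum.inr (g, 0), Sum.inl none), (.x, Sum.inr (g, 1), (s₁ g).vertex),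
      (.y, Sum.inr (g, 1), Sum.inl none), (.diff, Sum.inr (g, 2), Sum.inr (g, 1)),
      (.y, Sum.inr (g, 2), (s₂ g).vertex), (.x, Sum.inr (g, 0), Sum.inr (g, 2))] r
  | Sum.inr (Sum.inr i) => (.x, (f₁ i).vertex, (f₂ i).vertex)

variable {s₁ s₂ : G → Node I G} {f₁ f₂ : F → Node I G}

theorem programEdge_four (g : G) : programEdge s₁ s₂ f₁ f₂ (Sum.inr (Sum.inl (g, 4))) =
    (.y, Sum.inr (g, 2), (s₂ g).vertex) :=
  rfl

theorem programEdge_of_ne_four (s₂' : G → Node I G) (g : G) {r : Fin 6} (hr : r ≠ 4) :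
    programEdge s₁ s₂ f₁ f₂ (Sum.inr (Sum.inl (g, r))) =
      programEdge s₁ s₂' f₁ f₂ (Sum.inr (Sum.inl (g, r))) := by
  fin_cases r <;> first | exact absurd rfl hr | simp [programEdge]

/-- Vertices `(g, 1)` and `(g, 2)` belong to no node, so the gadget equations never degenerate,
whatever the gate reads. -/
theorem programEdge_ne (hf : ∀ i, f₁ i ≠ f₂ i) (r) :
    (programEdge s₁ s₂ f₁ f₂ r).2.1 ≠ (programEdge s₁ s₂ f₁ f₂ r).2.2 := by
  have hv (v : Node I G) (g : G) (c : Fin 3) (hc : c ≠ 0) : Sum.inr (g, c) ≠ v.vertex := by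
    rcases v with v | v <;> simp [Node.vertex, hc]
  rcases r with j | ⟨g, r⟩ | i
  · simp [programEdge]
  · fin_cases r <;> simp [programEdge, hv]
  · have hinj : Function.Injective (Node.vertex : Node I G → Vertex I G) :=
      Function.injective_id.sumMap fun g g' h => (Prod.mk.inj h).1
    exact hinj.ne (hf i)

variable [Fintype I] [Fintype G] [DecidableEq I] [DecidableEq G] {K : Type} [Field K]

/-- In a solution of the system, the values of the nodes are the differences of the
`x`-coordinates of their vertices to that of the zero node. -/
theorem program_values {b : F → ℚ} {p : Vertex I G ⊕ Vertex I G → K}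
    (h : ∀ r, ∑ a, (edgeVec (programEdge s₁ s₂ f₁ f₂ r) a : K) * p a =
      ((Sum.elim 0 (Sum.elim 0 b) r : ℚ) : K))
    (z : Node I G → K) (hz : ∀ v, z v = p (Sum.inl v.vertex) - p (Sum.inl (Sum.inl none))) :
    (∀ g, z (Sum.inr g) = z (s₁ g) + z (s₂ g)) ∧ ∀ i, z (f₁ i) - z (f₂ i) = b i := by
  simp only [sum_edgeVec] at h
  -- The `diff` equations to the zero vertex copy the relative value of a node from its `x`- to its
  -- `y`-coordinate.
  have hy (v : Node I G) : p (Sum.inr v.vertex) = p (Sum.inr (Sum.inl none)) + z v := by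
    rcases v with (_ | j) | g
    · simp [hz, Node.vertex]
    · have h1 := h (Sum.inl j)
      simp [programEdge, Commodity.xCoeff, Commodity.yCoeff] at h1
      simp only [hz, Node.vertex, Sum.map_inl, id]
      linear_combination -h1
    · have h1 := h (Sum.inr (Sum.inl (g, 0)))
      simp [programEdge, Commodity.xCoeff, Commodity.yCoeff] at h1
      simp only [hz, Node.vertex, Sum.map_inr]
      linear_combination -h1
  refine ⟨fun g => ?_, fun i => ?_⟩
  · have h1 := h (Sum.inr (Sum.inl (g, 1)))
    have h2 := h (Sum.inr (Sum.inl (g, 2)))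
    have h3 := h (Sum.inr (Sum.inl (g, 3)))
    have h4 := h (Sum.inr (Sum.inl (g, 4)))
    have h5 := h (Sum.inr (Sum.inl (g, 5)))
    have h6 := hy (s₂ g)
    have h7 := hz (s₁ g)
    have h8 := hz (Sum.inr g)
    simp [programEdge, Commodity.xCoeff, Commodity.yCoeff] at h1 h2 h3 h4 h5
    simp only [Node.vertex, Sum.map_inr] at h1 h4 h6 h7 h8
    -- Vertex `(g, 1)` has the `x` of `s₁ g` and the `y` of zero; `(g, 2)` has the same difference
    -- `x - y` but the `y` of `s₂ g`. So its `x`, passed on to `(g, 0)`, is the sum relative to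
    -- zero.
    linear_combination h8 - h7 + h5 + h3 + h4 + h6 + h1 - h2
  · have h1 := h (Sum.inr (Sum.inr i))
    simp [programEdge, Commodity.xCoeff, Commodity.yCoeff] at h1
    rw [hz, hz, ← h1]
    ring

theorem exists_program_solution {b : F → ℚ} {z : Node I G → K} (h0 : z (Sum.inl none) = 0)
    (hz : ∀ g, z (Sum.inr g) = z (s₁ g) + z (s₂ g)) (hb : ∀ i, z (f₁ i) - z (f₂ i) = b i) :
    ∃ p : Vertex I G ⊕ Vertex I G → K,
      ∀ r, ∑ a, (edgeVec (programEdge s₁ s₂ f₁ f₂ r) a : K) * p a =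
        ((Sum.elim 0 (Sum.elim 0 b) r : ℚ) : K) := by
  -- Put the zero vertex at the origin and give each node its value in both coordinates; the
  -- auxiliary vertices get `(z s₁, 0)` and `(z s₁ + z s₂, z s₂)`.
  let p : Vertex I G ⊕ Vertex I G → K := Sum.elim
    (Sum.elim (fun v => z (Sum.inl v)) fun g =>
      ![z (Sum.inr g.1), z (s₁ g.1), z (s₁ g.1) + z (s₂ g.1)] g.2)
    (Sum.elim (fun v => z (Sum.inl v)) fun g => ![z (Sum.inr g.1), 0, z (s₂ g.1)] g.2)
  have hx (v : Node I G) : p (Sum.inl v.vertex) = z v := by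
    rcases v with v | v <;> rfl
  have hy (v : Node I G) : p (Sum.inr v.vertex) = z v := by
    rcases v with v | v <;> rfl
  refine ⟨p, fun r => ?_⟩
  rw [sum_edgeVec]
  rcases r with j | ⟨g, r⟩ | i
  · simp [programEdge, Commodity.xCoeff, Commodity.yCoeff, p]
  · fin_cases r <;> simp [programEdge, Commodity.xCoeff, Commodity.yCoeff, hx, hy] <;>
      simp [p, hz, h0]
  · simp [programEdge, Commodity.xCoeff, Commodity.yCoeff, hx, hb]

end program

/-! ### From `classGz` to `classMC2` -/

/-- The gates of the program of a system: the multiples `2 ^ t * x j`, and for every row the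
partial sums of its positive and of its negative terms. -/
abbrev SysGate (m n w : ℕ) : Type :=
  (Fin n × Fin (w + 1)) ⊕ (Fin m × Bool × Fin (n * w + 1))

set_option synthInstance.maxSize 2000 in
instance decidableEqVertexSysGate (m n w : ℕ) : DecidableEq (Vertex (Fin n) (SysGate m n w)) :=
  inferInstance

/-! ### The straight-line program of a linear system -/

section sysProgram

variable {m n w : ℕ}

/-- The node with value `2 ^ t * x j`. -/
def mulNode (j : Fin n) (t : Fin (w + 1)) : Node (Fin n) (SysGate m n w) :=
  Sum.inr (Sum.inl (j, t))

/-- The partial sums of the positive (`c = false`) or negative (`c = true`) terms of row `i`. -/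
def accNode (i : Fin m) (c : Bool) (τ : Fin (n * w + 1)) : Node (Fin n) (SysGate m n w) :=
  Sum.inr (Sum.inr (i, c, τ))

/-- The first summands of the gates. -/
def sysSrc₁ : SysGate m n w → Node (Fin n) (SysGate m n w)
  | Sum.inl (j, t) => Fin.cases (Sum.inl (some j)) (fun t => mulNode j t.castSucc) t
  | Sum.inr (i, c, τ) => Fin.cases (Sum.inl none) (fun τ => accNode i c τ.castSucc) τ

/-- The second summands of the gates, depending on the bits `β` of the matrix. -/
def sysSrc₂ (β : Fin m → Bool → Fin n → Fin w → Bool) :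
    SysGate m n w → Node (Fin n) (SysGate m n w)
  | Sum.inl (j, t) => Fin.cases (Sum.inl none) (fun t => mulNode j t.castSucc) t
  | Sum.inr (i, c, τ) => Fin.cases (Sum.inl none)
      (fun τ => if β i c τ.divNat τ.modNat then mulNode τ.divNat τ.modNat.castSucc
        else Sum.inl none) τ

/-- The bits of the positive, respectively negative entries of the encoded matrix. -/
def entryBit (u : SysWire m n w → Bool) (i : Fin m) (c : Bool) (j : Fin n) (t : Fin w) : Bool :=
  u (Sum.inl (i, j, some t)) && (u (Sum.inl (i, j, none)) == c)

/-- The edges of the 2-commodity system for an encoded system. -/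
def sysEdge (β : Fin m → Bool → Fin n → Fin w → Bool) :
    Fin n ⊕ ((SysGate m n w × Fin 6) ⊕ Fin m) →
      Commodity × Vertex (Fin n) (SysGate m n w) × Vertex (Fin n) (SysGate m n w) :=
  programEdge sysSrc₁ (sysSrc₂ β) (fun i => accNode i false (Fin.last _))
    fun i => accNode i true (Fin.last _)

theorem partialSum_last {K : Type} [AddCommMonoid K] {k : ℕ} (f : Fin k → K) :
    Fin.partialSum f (Fin.last k) = ∑ i, f i := by
  rw [Fin.partialSum, Fin.val_last, List.take_of_length_le (by simp), List.sum_ofFn]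

variable {K : Type} [Field K]

/-- The term that is added in step `τ` of the summation of a row. -/
def rowTerm (β : Fin m → Bool → Fin n → Fin w → Bool) (x : Fin n → K) (i : Fin m) (c : Bool)
    (τ : Fin (n * w)) : K :=
  if β i c τ.divNat τ.modNat then 2 ^ (τ.modNat : ℕ) * x τ.divNat else 0

/-- Each entry is expanded in binary, and its sign bit routes all its terms into one of the two
sums. -/
theorem sum_rowTerm_entryBit (u : SysWire m n w → Bool) (x : Fin n → K) (i : Fin m) :
    ∑ τ, rowTerm (entryBit u) x i false τ - ∑ τ, rowTerm (entryBit u) x i true τ =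
      ∑ j, (inMat (i, j) u : K) * x j := by
  have h (c : Bool) : ∑ τ, rowTerm (entryBit u) x i c τ =
      ∑ j, ∑ t, if entryBit u i c j t then 2 ^ (t : ℕ) * x j else 0 := by
    rw [← Fintype.sum_prod_type', ← finProdFinEquiv.symm.sum_comp]
    rfl
  rw [h, h, ← Finset.sum_sub_distrib]
  refine Finset.sum_congr rfl fun j _ => ?_
  rw [← Finset.sum_sub_distrib]
  simp only [inMat, intVal, natVal]
  push_cast
  rw [mul_assoc, Finset.sum_mul, Finset.mul_sum]
  refine Finset.sum_congr rfl fun t _ => ?_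
  cases h1 : u (Sum.inl (i, j, none)) <;> cases h2 : u (Sum.inl (i, j, some t)) <;>
    simp [entryBit, h1, h2]

/-- The values of the nodes when the inputs have the values `x`. -/
def sysVal (β : Fin m → Bool → Fin n → Fin w → Bool) (x : Fin n → K) :
    Node (Fin n) (SysGate m n w) → K
  | Sum.inl none => 0
  | Sum.inl (some j) => x j
  | Sum.inr (Sum.inl (j, t)) => 2 ^ (t : ℕ) * x j
  | Sum.inr (Sum.inr (i, c, τ)) => Fin.partialSum (rowTerm β x i c) τ

theorem sysVal_gate (β : Fin m → Bool → Fin n → Fin w → Bool) (x : Fin n → K)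
    (g : SysGate m n w) :
    sysVal β x (Sum.inr g) = sysVal β x (sysSrc₁ g) + sysVal β x (sysSrc₂ β g) := by
  rcases g with ⟨j, t⟩ | ⟨i, c, τ⟩
  · cases t using Fin.cases with
    | zero => simp [sysVal, sysSrc₁, sysSrc₂]
    | succ t =>
      simp [sysVal, sysSrc₁, sysSrc₂, mulNode, pow_succ]
      ring
  · cases τ using Fin.cases with
    | zero => simp [sysVal, sysSrc₁, sysSrc₂]
    | succ τ =>
      simp only [sysVal, sysSrc₁, sysSrc₂, accNode, mulNode, Fin.cases_succ, Fin.partialSum_succ]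
      congr 1
      rw [rowTerm]
      split_ifs <;> rfl

/-- The program has no cycles, so its inputs determine all values: induct along the doublings, then
along the partial sums. -/
theorem eq_sysVal {β : Fin m → Bool → Fin n → Fin w → Bool}
    {z : Node (Fin n) (SysGate m n w) → K} (h0 : z (Sum.inl none) = 0)
    (hz : ∀ g, z (Sum.inr g) = z (sysSrc₁ g) + z (sysSrc₂ β g)) :
    z = sysVal β fun j => z (Sum.inl (some j)) := by
  have hmul (j : Fin n) (t : Fin (w + 1)) : z (Sum.inr (Sum.inl (j, t))) =
      2 ^ (t : ℕ) * z (Sum.inl (some j)) := by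
    induction t using Fin.induction with
    | zero => simp [hz, sysSrc₁, sysSrc₂, h0]
    | succ t ih =>
      rw [hz]
      simp only [sysSrc₁, sysSrc₂, mulNode, Fin.cases_succ, ih, Fin.val_castSucc, Fin.val_succ]
      ring
  funext v
  rcases v with (_ | j) | ⟨j, t⟩ | ⟨i, c, τ⟩
  · exact h0
  · rfl
  · exact hmul j t
  · induction τ using Fin.induction with
    | zero => simp [hz, sysSrc₁, sysSrc₂, h0, sysVal]
    | succ τ ih =>
      rw [hz]
      simp only [sysSrc₁, sysSrc₂, accNode, mulNode, Fin.cases_succ, ih, sysVal,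
        Fin.partialSum_succ]
      congr 1
      rw [rowTerm]
      split_ifs
      · exact hmul _ _
      · exact h0

variable {u : SysWire m n w → Bool} {b : Fin m → ℚ}

theorem exists_sysEdge_solution {x : Fin n → K}
    (hx : ∀ i, ∑ j, (inMat (i, j) u : K) * x j = (b i : K)) :
    ∃ p : Vertex (Fin n) (SysGate m n w) ⊕ Vertex (Fin n) (SysGate m n w) → K,
      ∀ r, ∑ a, (edgeVec (sysEdge (entryBit u) r) a : K) * p a =
        ((Sum.elim 0 (Sum.elim 0 b) r : ℚ) : K) := by
  refine exists_program_solution (z := sysVal (entryBit u) x) rfl (sysVal_gate _ _) fun i => ?_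
  rw [← hx, ← sum_rowTerm_entryBit]
  simp only [sysVal, accNode, partialSum_last]

/-- The differences to the zero vertex solve the original system. Adding the coordinate of that
vertex to all unknowns changes nothing, because the rows sum to zero; so the raw coordinates are a
solution too. -/
theorem sum_inMat_of_sysEdge (hsum : ∀ i, ∑ j, inMat (i, j) u = 0)
    {p : Vertex (Fin n) (SysGate m n w) ⊕ Vertex (Fin n) (SysGate m n w) → K}
    (hp : ∀ r, ∑ a, (edgeVec (sysEdge (entryBit u) r) a : K) * p a =
        ((Sum.elim 0 (Sum.elim 0 b) r : ℚ) : K)) (i : Fin m) :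
    ∑ j, (inMat (i, j) u : K) * p (Sum.inl (Sum.inl (some j))) = (b i : K) := by
  let z : Node (Fin n) (SysGate m n w) → K := fun v =>
    p (Sum.inl v.vertex) - p (Sum.inl (Sum.inl none))
  obtain ⟨h1, h2⟩ := program_values hp z fun v => rfl
  have hz := eq_sysVal (sub_self _) h1
  have h3 := h2 i
  rw [hz] at h3
  simp only [sysVal, accNode, partialSum_last] at h3
  rw [sum_rowTerm_entryBit] at h3
  have h4 : ∑ j, (inMat (i, j) u : K) = 0 := by
    exact_mod_cast congrArg (Int.cast : ℤ → K) (hsum i)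
  rw [← h3]
  simp only [z, mul_sub, Finset.sum_sub_distrib, ← Finset.sum_mul, h4, zero_mul, sub_zero]
  rfl

end sysProgram

/-! ### Computing the 2-commodity matrix -/

theorem inTC0_entryBit : InTC0 sysSize fun (p : ℕ × ℕ × ℕ)
    (k : Fin p.1 × Bool × Fin p.2.1 × Fin p.2.2) (u : SysWire p.1 p.2.1 p.2.2 → Bool) =>
      entryBit u k.1 k.2.1 k.2.2.1 k.2.2.2 = true := by
  refine ((InTC0.var sysSize fun (p : ℕ × ℕ × ℕ) (k : Fin p.1 × Bool × Fin p.2.1 × Fin p.2.2) =>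
    (Sum.inl (k.1, k.2.2.1, some k.2.2.2) : SysWire p.1 p.2.1 p.2.2)).and
      ((InTC0.var sysSize fun (p : ℕ × ℕ × ℕ) (k : Fin p.1 × Bool × Fin p.2.1 × Fin p.2.2) =>
        (Sum.inl (k.1, k.2.2.1, none) : SysWire p.1 p.2.1 p.2.2)).iff
          (InTC0.const _ fun p k => k.2.1 = true))).congr fun p k x => ?_
  rw [entryBit, Bool.and_eq_true, beq_iff_eq, Bool.eq_iff_iff (b := k.2.1)]

/-- The vertices of the 2-commodity system of a system of given size. -/
abbrev SysVertex (p : ℕ × ℕ × ℕ) : Type := Vertex (Fin p.2.1) (SysGate p.1 p.2.1 p.2.2)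

/-- The equations of the 2-commodity system of a system of given size. -/
abbrev SysRow (p : ℕ × ℕ × ℕ) : Type :=
  Fin p.2.1 ⊕ ((SysGate p.1 p.2.1 p.2.2 × Fin 6) ⊕ Fin p.1)

/-- Only the equations for the second summands of the partial sums depend on the matrix. -/
theorem sysEdge_cases {m n w : ℕ} (r : Fin n ⊕ ((SysGate m n w × Fin 6) ⊕ Fin m)) :
    (∀ β, sysEdge β r = sysEdge (fun _ _ _ _ => true) r) ∨
      ∃ k : Fin m × Bool × Fin n × Fin w, ∃ e₁ e₂, ∀ β,
        sysEdge β r = if β k.1 k.2.1 k.2.2.1 k.2.2.2 = true then e₁ else e₂ := by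
  rcases r with j | ⟨g, r⟩ | i
  · exact Or.inl fun _ => rfl
  · by_cases hr : r = 4
    · subst hr
      simp only [sysEdge, programEdge_four]
      rcases g with ⟨j, t⟩ | ⟨i, c, τ⟩
      · exact Or.inl fun _ => by simp only [sysSrc₂]
      · cases τ using Fin.cases with
        | zero => exact Or.inl fun _ => by simp only [sysSrc₂, Fin.cases_zero]
        | succ τ =>
          refine Or.inr ⟨(i, c, τ.divNat, τ.modNat),
            (.y, Sum.inr (Sum.inr (i, c, τ.succ), 2), (mulNode τ.divNat τ.modNat.castSucc).vertex),
            (.y, Sum.inr (Sum.inr (i, c, τ.succ), 2), Node.vertex (Sum.inl none)), fun β => ?_⟩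
          simp only [sysSrc₂, Fin.cases_succ]
          split_ifs <;> rfl
    · exact Or.inl fun β => programEdge_of_ne_four _ g hr
  · exact Or.inl fun _ => rfl

/-- By `sysEdge_cases`, an entry of the new matrix is a constant or a choice between two constants
by a single `entryBit`. -/
theorem tc0Int_sysEdge : TC0Int sysSize fun (p : ℕ × ℕ × ℕ)
    (k : SysRow p × (SysVertex p ⊕ SysVertex p)) (u : SysWire p.1 p.2.1 p.2.2 → Bool) =>
      edgeVec (sysEdge (entryBit u) k.1) k.2 := by
  have hite : TC0Int sysSize fun (p : ℕ × ℕ × ℕ)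
      (k : (Fin p.1 × Bool × Fin p.2.1 × Fin p.2.2) × ℤ × ℤ) u =>
        if entryBit u k.1.1 k.1.2.1 k.1.2.2.1 k.1.2.2.2 = true then k.2.1 else k.2.2 :=
    (TC0Int.ite (inTC0_entryBit.reindex fun (p : ℕ × ℕ × ℕ)
      (k : (Fin p.1 × Bool × Fin p.2.1 × Fin p.2.2) × ℤ × ℤ) => k.1)
      (TC0Int.const _ fun p k => k.2.1) (TC0Int.const _ fun p k => k.2.2)).congr
        fun p k x => by split_ifs <;> rfl
  refine ((TC0Int.const sysSize fun _ (z : ℤ) => z).sumElim hite).of_exists ?_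
  rintro p ⟨r, a⟩
  obtain h | ⟨k, e₁, e₂, h⟩ := sysEdge_cases r
  · refine ⟨Sum.inl (edgeVec (sysEdge (fun _ _ _ _ => true) r) a), funext fun u => ?_⟩
    simp only [h (entryBit u), Sum.elim_inl]
  · refine ⟨Sum.inr (k, edgeVec e₁ a, edgeVec e₂ a), funext fun u => ?_⟩
    simp only [h (entryBit u), Sum.elim_inr]
    split_ifs <;> rfl

theorem tc0Reducible_classGz_classMC2 : TC0Reducible classGz classMC2 := by
  have hm : PolyBounded sysSize fun p => p.1 := .of_le fun p => by simp only [sysSize]; omega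
  have hn : PolyBounded sysSize fun p => p.2.1 := .of_le fun p => by simp only [sysSize]; omega
  have hw : PolyBounded sysSize fun p => p.2.2 := .of_le fun p => by simp only [sysSize]; omega
  have hl : PolyBounded solSize fun q => q.2 := .of_le fun q => by simp only [solSize]; omega
  have hG : PolyBounded sysSize fun p => Fintype.card (SysGate p.1 p.2.1 p.2.2) := by
    simp only [Fintype.card_sum, Fintype.card_prod, Fintype.card_fin, Fintype.card_bool]
    exact (hn.mul (hw.add (.const _ 1))).add
      (hm.mul ((PolyBounded.const _ 2).mul ((hn.mul hw).add (.const _ 1))))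
  have hV : PolyBounded sysSize fun p => Fintype.card (SysVertex p) := by
    have h : (fun p => Fintype.card (SysVertex p)) =
        fun p => p.2.1 + 1 + Fintype.card (SysGate p.1 p.2.1 p.2.2) * 3 := by
      funext p
      rw [Fintype.card_sum, Fintype.card_prod, Fintype.card_option, Fintype.card_fin,
        Fintype.card_fin]
    rw [h]
    exact (hn.add (.const _ 1)).add (hG.mul (.const _ 3))
  have hM : PolyBounded sysSize fun p => Fintype.card (SysRow p) := by
    have h : (fun p => Fintype.card (SysRow p)) =
        fun p => p.2.1 + (Fintype.card (SysGate p.1 p.2.1 p.2.2) * 6 + p.1) := by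
      funext p
      rw [Fintype.card_sum, Fintype.card_sum, Fintype.card_prod, Fintype.card_fin,
        Fintype.card_fin, Fintype.card_fin]
    rw [h]
    exact hn.add ((hG.mul (.const _ 6)).add hm)
  refine TC0Reducible.of_systems (ρ := SysRow) (γ := fun p => SysVertex p ⊕ SysVertex p)
    (M := fun p => Fintype.card (SysRow p))
    (N := fun p => Fintype.card (SysVertex p) + Fintype.card (SysVertex p))
    -- The final `+ 1` makes `W` positive, so that entries `±1` and denominators `1` fit.
    (W := fun p => Fintype.card (SysRow p) +
      (Fintype.card (SysVertex p) + Fintype.card (SysVertex p)) + p.2.2 + 1)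
    (L := fun q => q.2) (fun p => Fintype.equivFin _)
    (fun p => (Equiv.sumCongr (Fintype.equivFin _) (Fintype.equivFin _)).trans finSumFinEquiv)
    hM (hV.add hV) (((hM.add (hV.add hV)).add hw).add (.const _ 1)) hl (fun p => by omega)
    (fun p => by omega) tc0Int_sysEdge
    (num := fun p => Sum.elim (fun _ _ => 0) (Sum.elim (fun _ _ => 0) inNum))
    (den := fun p => Sum.elim (fun _ _ => 1) (Sum.elim (fun _ _ => 1) inDen))
    ((TC0Int.const _ _).sumElim ((TC0Int.const _ _).sumElim tc0Int_inNum))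
    ((TC0Nat.const _ _).sumElim ((TC0Nat.const _ _).sumElim tc0Nat_inDen)) ?_ ?_ ?_
    (rnum := fun q j => vecNum (finSumFinEquiv (Sum.inl
      (Fintype.equivFin (SysVertex q.1) (Sum.inl (some j))))))
    (rden := fun q j => vecDen (finSumFinEquiv (Sum.inl
      (Fintype.equivFin (SysVertex q.1) (Sum.inl (some j))))))
    ((tc0Int_vecNum (N := fun p =>
      Fintype.card (SysVertex p) + Fintype.card (SysVertex p))).reindex _)
    ((tc0Nat_vecDen (N := fun p =>
      Fintype.card (SysVertex p) + Fintype.card (SysVertex p))).reindex _)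
    (fun q k x => natAbs_intVal_lt _) (fun q k x => natVal_lt _) ?_
  · exact fun p k x => (natAbs_edgeVec_le _ _).trans_lt (Nat.one_lt_two_pow (Nat.succ_ne_zero _))
  · rintro p (j | g | i) x
    · exact Nat.two_pow_pos _
    · exact Nat.two_pow_pos _
    · exact natAbs_inNum_lt (by omega) _ _
  · rintro p (j | g | i) x
    · exact Nat.one_lt_two_pow (Nat.succ_ne_zero _)
    · exact Nat.one_lt_two_pow (Nat.succ_ne_zero _)
    · exact inDen_lt (by omega) _ _
  · rintro m n w A b u ⟨⟨hrow, hcol⟩, hsum⟩ ⟨hA, hb⟩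
    have hA (i j) : inMat (i, j) u = A i j := hA i j
    have hsum' (i) : ∑ j, inMat (i, j) u = 0 := by simpa only [hA] using hsum i
    refine ⟨⟨_, rfl, fun r => isTwoCommodityRow_edgeVec (Fintype.equivFin (SysVertex (m, n, w)))
      (programEdge_ne (fun i => ?_) _)⟩, Sum.elim 0 (Sum.elim 0 b), ?_, ⟨?_, ?_⟩, ?_⟩
    · simp [accNode]
    · rintro (j | g | i)
      · simp
      · simp
      · exact hb i
    · rintro ⟨x, hx⟩
      exact exists_sysEdge_solution fun i => by simpa only [hA] using hx i
    · rintro ⟨x', hx'⟩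
      exact ⟨_, fun i => by simpa only [hA] using sum_inMat_of_sysEdge hsum' hx' i⟩
    · intro l x' v hx' hv
      exact ⟨_, fun j => hv (Sum.inl (Sum.inl (some j))),
        fun i => by simpa only [hA] using sum_inMat_of_sysEdge hsum' hx' i⟩

theorem TC0Reducible.mono {𝒞 𝒞' 𝒟 : MatrixClass} (h : TC0Reducible 𝒞 𝒟)
    (h' : ∀ m n, 𝒞' m n ⊆ 𝒞 m n) : TC0Reducible 𝒞' 𝒟 := by
  obtain ⟨M, N, W, L, F, R, hM, hN, hW, hL, hF, hR, h⟩ := h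
  exact ⟨M, N, W, L, F, R, hM, hN, hW, hL, hF, hR,
    fun m n w A b u hA => h m n w A b u (h' m n hA)⟩

end TC0Lin

theorem mainTheorem5 :
    TC0Lin.TC0Reducible TC0Lin.classG TC0Lin.classGz ∧
    TC0Lin.TC0Reducible TC0Lin.classGz TC0Lin.classGz2 ∧
    TC0Lin.TC0Reducible TC0Lin.classGz2 TC0Lin.classMC2 :=
  ⟨TC0Lin.tc0Reducible_classG_classGz, TC0Lin.tc0Reducible_classGz_classGz2,
    -- Binary expansion handles every matrix of `classGz`, which contains `classGz2`.
    TC0Lin.tc0Reducible_classGz_classMC2.mono fun _ _ _ hA => hA.1⟩
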